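/- Let $M$ be a strongly causal spacetime (a connected, Hausdorff, second countable smooth manifold of dimension at least $2$ with a smooth Lorentzian metric and a time orientation), with chronological relation $\ll$. For $S\subset M$ write $I^-[S]=\{p: p\ll q \text{ for some } q\in S\}$, $I^-(p)=I^-[\{p\}]$ and ${\downarrow}S=I^-[\{p: p\ll q \text{ for all } q\in S\}]$; define $I^+[S]$, $I^+(p)$, ${\uparrow}S$ dually. An *IP* is a nonempty set $P=I^-[P]$ that is not the union of two proper subsets $A=I^-[A]$, $B=I^-[B]$; a *TIP* is an IP not of the form $I^-(p)$, $p\in M$. IFs and TIFs are defined dually. For an IP $P$ and an IF $F$ put $P\sim_S F$ if $F$ is a maximal IF in ${\uparrow}P$ and $P$ is a maximal IP in ${\downarrow}F$; further put $P\sim_S\emptyset$ (resp. $\emptyset\sim_S F$) if the IP $P$ (resp. the IF $F$) is not S-related in this way to any IF (resp. IP). Let $\overline M$ be a standard completion of $M$, that is: $\overline M$ is a set of pairs $(P,F)$ with $P$ an IP or $\emptyset$, $F$ an IF or $\emptyset$, and $P\sim_S F$, which contains $\mathbf i(p)=(I^-(p),I^+(p))$ for all $p\in M$ and such that every TIP and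 every TIF of $M$ is a component of some pair in $\partial M:=\overline M\setminus\mathbf i(M)$; it is endowed with the relation $(P,F)\,\overline{\ll}\,(P',F')\Leftrightarrow F\cap P'\neq\emptyset$ and with the chronological topology, in which $C\subset\overline M$ is closed iff $L(\sigma)\subset C$ for every sequence $\sigma$ in $C$. Here, for $\sigma=\{(P_n,F_n)\}_n$, $(P,F)\in L(\sigma)$ iff: whenever $P\ne\emptyset$, $P\subset\liminf P_n$ and $P$ is a maximal IP in $\limsup P_n$; and whenever $F\neq\emptyset$, $F\subset\liminf F_n$ and $F$ is a maximal IF in $\limsup F_n$ (set-theoretic $\liminf$, $\limsup$). Write $I^\pm((P,F))\subset\overline M$ for the future and past of $(P,F)$ with respect to $\overline{\ll}$. Then: (i) Every chain in $\overline M$, i.e. every sequence $\{x_n\}$ with $x_n\,\overline{\ll}\,x_{n+1}$ for all $n$ (future-directed), or with $x_{n+1}\,\overline{\ll}\,x_n$ for all $n$ (past-directed), has a limit in $\overline M$. Moreover, for every future- or past-directed timelike curve $\gamma:[a,b)\to M$, $b\le\infty$, which has no continuous extension to $b$ in $M$, $\mathbf i(\gamma(t))$ has a limit in $\partial M$ as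 $t\to b$. (ii) The inclusion $\mathbf i:M\to\overline M$ is a topological embedding, and $\mathbf i(M)$ is dense in $\overline M$. (iii) The boundary $\partial M$ is closed in $\overline M$. (iv) $I^+((P,F))$ and $I^-((P,F))$ are open for every $(P,F)\in\overline M$. (v) Every point of $\overline M$ is closed, i.e. the topology is $T_1$. -/

import Mathlib

open Set Filter Topology
open scoped Manifold ContDiff

/-! ## Order-theoretic notions attached to a chronological relation

Throughout, `r p q` stands for `p ≪ q`. Every past notion has a future dual, which is the past
notion of the opposite relation `Function.swap r`. -/

namespace CBoundary

section Relation

variable {X : Type*}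

/-- The past `I⁻[S]` of a set. -/
def past (r : X → X → Prop) (S : Set X) : Set X := {p | ∃ q ∈ S, r p q}

/-- The future `I⁺[S]` of a set. -/
def future (r : X → X → Prop) (S : Set X) : Set X := past (Function.swap r) S

/-- The common past `↓S = I⁻[{p | p ≪ q for all q ∈ S}]`. -/
def commonPast (r : X → X → Prop) (S : Set X) : Set X := past r {p | ∀ q ∈ S, r p q}

/-- The common future `↑S = I⁺[{p | q ≪ p for all q ∈ S}]`. -/
def commonFuture (r : X → X → Prop) (S : Set X) : Set X := commonPast (Function.swap r) S

/-- Past sets: sets that coincide with their past. -/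
def IsPastSet (r : X → X → Prop) (P : Set X) : Prop := past r P = P

/-- Indecomposable past sets (IPs): nonempty past sets that are not the union of two proper
subsets which are past sets. (The empty set is adjoined separately below.) -/
def IsIP (r : X → X → Prop) (P : Set X) : Prop :=
  P.Nonempty ∧ IsPastSet r P ∧
    ¬ ∃ A B : Set X, IsPastSet r A ∧ IsPastSet r B ∧ A ⊂ P ∧ B ⊂ P ∧ A ∪ B = P

/-- Indecomposable future sets (IFs). -/
def IsIF (r : X → X → Prop) (F : Set X) : Prop := IsIP (Function.swap r) F

/-- Terminal indecomposable past sets (TIPs): IPs that are not the past of a point. -/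
def IsTIP (r : X → X → Prop) (P : Set X) : Prop := IsIP r P ∧ ¬ ∃ p, P = past r {p}

/-- Terminal indecomposable future sets (TIFs). -/
def IsTIF (r : X → X → Prop) (F : Set X) : Prop := IsTIP (Function.swap r) F

/-- `P` is a maximal IP in `S` (and is contained in `S`). -/
def IsMaximalIP (r : X → X → Prop) (S P : Set X) : Prop :=
  Maximal (fun Q : Set X => IsIP r Q ∧ Q ⊆ S) P

/-- `F` is a maximal IF in `S` (and is contained in `S`). -/
def IsMaximalIF (r : X → X → Prop) (S F : Set X) : Prop := IsMaximalIP (Function.swap r) S F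

/-- The S-relation between an IP `P` and an IF `F`. -/
def SRelNonempty (r : X → X → Prop) (P F : Set X) : Prop :=
  IsMaximalIF r (commonFuture r P) F ∧ IsMaximalIP r (commonPast r F) P

/-- The S-relation `P ∼_S F`, where `P` is an IP or empty and `F` is an IF or empty. -/
def SRel (r : X → X → Prop) (P F : Set X) : Prop :=
  SRelNonempty r P F ∨
  (IsIP r P ∧ F = ∅ ∧ ¬ ∃ F', SRelNonempty r P F') ∨
  (P = ∅ ∧ IsIF r F ∧ ¬ ∃ P', SRelNonempty r P' F)

/-- The pair `(I⁻(p), I⁺(p))` attached to a point `p`. -/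
def pointPair (r : X → X → Prop) (p : X) : Set X × Set X := (past r {p}, future r {p})

/-- Admissible completions as a point set. -/
structure AdmissibleCompletion (r : X → X → Prop) where
  /-- The underlying set of pairs. -/
  carrier : Set (Set X × Set X)
  isIP_or_empty : ∀ x ∈ carrier, IsIP r x.1 ∨ x.1 = ∅
  isIF_or_empty : ∀ x ∈ carrier, IsIF r x.2 ∨ x.2 = ∅
  pointPair_mem : ∀ p, pointPair r p ∈ carrier
  tip_complete : ∀ P, IsTIP r P → ∃ F, (P, F) ∈ carrier \ range (pointPair r)
  tif_complete : ∀ F, IsTIF r F → ∃ P, (P, F) ∈ carrier \ range (pointPair r)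
  sRel : ∀ x ∈ carrier, SRel r x.1 x.2

namespace AdmissibleCompletion

variable {r : X → X → Prop} (Mbar : AdmissibleCompletion r)

/-- The points `(P, F)` of the completion. -/
def Point : Type _ := {x : Set X × Set X // x ∈ Mbar.carrier}

variable {Mbar}

/-- The component `P` of a point `(P, F)`. -/
def Point.P (x : Mbar.Point) : Set X := x.1.1

/-- The component `F` of a point `(P, F)`. -/
def Point.F (x : Mbar.Point) : Set X := x.1.2

/-- The extended chronological relation on the completion. -/
def Point.Chr (x y : Mbar.Point) : Prop := (x.F ∩ y.P).Nonempty

variable (Mbar)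

/-- The inclusion of the space in its completion. -/
def incl (p : X) : Mbar.Point := ⟨pointPair r p, Mbar.pointPair_mem p⟩

/-- The boundary of the completion. -/
def boundary : Set Mbar.Point := (range Mbar.incl)ᶜ

variable {Mbar}

/-- The limit operator `L` on sequences of points of the completion; `liminf` and `limsup` are
those of sequences of sets. -/
def limitOp (σ : ℕ → Mbar.Point) : Set Mbar.Point :=
  {x | (x.P.Nonempty → x.P ⊆ liminf (fun n => (σ n).P) atTop ∧
          IsMaximalIP r (limsup (fun n => (σ n).P) atTop) x.P) ∧
       (x.F.Nonempty → x.F ⊆ liminf (fun n => (σ n).F) atTop ∧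
          IsMaximalIF r (limsup (fun n => (σ n).F) atTop) x.F)}

theorem liminf_subset_comp (A : ℕ → Set X) {φ : ℕ → ℕ} (hφ : StrictMono φ) :
    liminf A atTop ⊆ liminf (fun n => A (φ n)) atTop := by
  intro a ha
  rw [mem_liminf_iff_eventually_mem] at ha ⊢
  exact hφ.tendsto_atTop.eventually ha

theorem limsup_comp_subset (A : ℕ → Set X) {φ : ℕ → ℕ} (hφ : StrictMono φ) :
    limsup (fun n => A (φ n)) atTop ⊆ limsup A atTop := by
  intro a ha
  rw [mem_limsup_iff_frequently_mem] at ha ⊢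
  exact hφ.tendsto_atTop.frequently ha

theorem isMaximalIP_comp (A : ℕ → Set X) {φ : ℕ → ℕ} (hφ : StrictMono φ) {s : X → X → Prop}
    {P : Set X} (hne : P ⊆ liminf A atTop ∧ IsMaximalIP s (limsup A atTop) P) :
    P ⊆ liminf (fun n => A (φ n)) atTop ∧
      IsMaximalIP s (limsup (fun n => A (φ n)) atTop) P := by
  obtain ⟨hinf, hmax⟩ := hne
  have h1 := hinf.trans (liminf_subset_comp A hφ)
  refine ⟨h1, ⟨hmax.1.1, h1.trans ?_⟩, fun Q hQ hPQ =>
    hmax.2 ⟨hQ.1, hQ.2.trans (limsup_comp_subset A hφ)⟩ hPQ⟩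
  intro a ha
  rw [mem_liminf_iff_eventually_mem] at ha
  rw [mem_limsup_iff_frequently_mem]
  exact ha.frequently

/-- Passing to a subsequence enlarges the set of limits. -/
theorem limitOp_subset_comp (σ : ℕ → Mbar.Point) {φ : ℕ → ℕ} (hφ : StrictMono φ) :
    limitOp σ ⊆ limitOp (fun n => σ (φ n)) := fun _ hx =>
  ⟨fun h => isMaximalIP_comp (fun n => (σ n).P) hφ (hx.1 h),
   fun h => isMaximalIP_comp (fun n => (σ n).F) hφ (hx.2 h)⟩

variable (Mbar)

/-- The chronological topology: a set `C` is closed iff `L(σ) ⊆ C` for each sequence `σ` in `C`. -/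
instance chrTopology : TopologicalSpace Mbar.Point :=
  TopologicalSpace.ofClosed {C | ∀ σ : ℕ → Mbar.Point, (∀ n, σ n ∈ C) → limitOp σ ⊆ C}
    (fun _ hσ => absurd (hσ 0) (notMem_empty _))
    (fun _ hA σ hσ _ hx C hC => hA hC σ (fun n => hσ n C hC) hx)
    (by
      intro A hA B hB σ hσ x hx
      have key : (∃ᶠ n in atTop, σ n ∈ A) ∨ (∃ᶠ n in atTop, σ n ∈ B) :=
        frequently_or_distrib.mp (Frequently.of_forall hσ)
      rcases key with h | h
      · obtain ⟨φ, hφ, hm⟩ := extraction_of_frequently_atTop h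
        exact Or.inl (hA _ hm (limitOp_subset_comp σ hφ hx))
      · obtain ⟨φ, hφ, hm⟩ := extraction_of_frequently_atTop h
        exact Or.inr (hB _ hm (limitOp_subset_comp σ hφ hx)))

end AdmissibleCompletion

end Relation

/-! ## Spacetimes -/

section Spacetimes

/-- A smooth Lorentzian metric (signature `(-, +, …, +)`) and a time orientation, given by a
continuous timelike vector field, on a smooth `n`-manifold. -/
structure Spacetime (n : ℕ) (M : Type*) [TopologicalSpace M]
    [ChartedSpace (EuclideanSpace ℝ (Fin n)) M] [IsManifold (𝓡 n) ∞ M] where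
  /-- The metric tensor. -/
  g (x : M) : TangentSpace (𝓡 n) x →L[ℝ] TangentSpace (𝓡 n) x →L[ℝ] ℝ
  symm (x : M) (v w : TangentSpace (𝓡 n) x) : g x v w = g x w v
  /-- At each point there is a timelike vector with spacelike orthogonal complement. -/
  lorentzian (x : M) : ∃ v : TangentSpace (𝓡 n) x, g x v v < 0 ∧
    ∀ w : TangentSpace (𝓡 n) x, g x v w = 0 → w ≠ 0 → 0 < g x w w
  contMDiff : ContMDiff (𝓡 n)
    ((𝓡 n).prod 𝓘(ℝ, EuclideanSpace ℝ (Fin n) →L[ℝ] EuclideanSpace ℝ (Fin n) →L[ℝ] ℝ)) ∞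
    (fun x => Bundle.TotalSpace.mk'
      (EuclideanSpace ℝ (Fin n) →L[ℝ] EuclideanSpace ℝ (Fin n) →L[ℝ] ℝ)
      (E := fun x : M => TangentSpace (𝓡 n) x →L[ℝ] TangentSpace (𝓡 n) x →L[ℝ] ℝ) x (g x))
  /-- The vector field that defines the time orientation. -/
  orient (x : M) : TangentSpace (𝓡 n) x
  orient_timelike (x : M) : g x (orient x) (orient x) < 0
  orient_continuous : Continuous (fun x => (⟨x, orient x⟩ : TangentBundle (𝓡 n) M))

namespace Spacetime

variable {n : ℕ} {M : Type*} [TopologicalSpace M]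
  [ChartedSpace (EuclideanSpace ℝ (Fin n)) M] [IsManifold (𝓡 n) ∞ M] (S : Spacetime n M)

/-- Future-directed timelike tangent vectors. -/
def FutureTimelike (x : M) (v : TangentSpace (𝓡 n) x) : Prop :=
  S.g x v v < 0 ∧ S.g x v (S.orient x) < 0

/-- Past-directed timelike tangent vectors. -/
def PastTimelike (x : M) (v : TangentSpace (𝓡 n) x) : Prop :=
  S.g x v v < 0 ∧ 0 < S.g x v (S.orient x)

/-- Future-directed causal (timelike or lightlike) tangent vectors. -/
def FutureCausal (x : M) (v : TangentSpace (𝓡 n) x) : Prop :=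
  v ≠ 0 ∧ S.g x v v ≤ 0 ∧ S.g x v (S.orient x) < 0

/-- `γ` is smooth on `[a, b]`, `a < b`, with all velocities (one-sided at the ends) in `C`. -/
def SmoothOnWith (C : ∀ x : M, TangentSpace (𝓡 n) x → Prop) (γ : ℝ → M) (a b : ℝ) : Prop :=
  a < b ∧ ContMDiffOn 𝓘(ℝ, ℝ) (𝓡 n) ∞ γ (Icc a b) ∧
    ∀ t ∈ Icc a b, C (γ t) (mfderivWithin 𝓘(ℝ, ℝ) (𝓡 n) γ (Icc a b) t (1 : ℝ))

/-- `γ` is piecewise smooth on `[a, b]`, `a < b`, with all one-sided velocities in `C`: there are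
finitely many points `a = t₀ < t₁ < ⋯ < tₖ = b`, `k ≥ 1`, such that `γ` is smooth with velocities
in `C` on each `[tᵢ, tᵢ₊₁]`. -/
def PiecewiseSmoothOnWith (C : ∀ x : M, TangentSpace (𝓡 n) x → Prop) (γ : ℝ → M) :
    ℝ → ℝ → Prop :=
  Relation.TransGen (SmoothOnWith C γ)

/-- The chronological relation `p ≪ q`: some future-directed timelike curve runs from `p` to
`q`. -/
def Chr (p q : M) : Prop :=
  ∃ (γ : ℝ → M) (a b : ℝ), PiecewiseSmoothOnWith S.FutureTimelike γ a b ∧ γ a = p ∧ γ b = q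

/-- Strong causality: each neighbourhood `U` of each point contains a neighbourhood `V` of the
point such that causal curve segments with endpoints in `V` lie entirely in `U`. -/
def StronglyCausal : Prop :=
  ∀ p : M, ∀ U ∈ 𝓝 p, ∃ V ∈ 𝓝 p, V ⊆ U ∧ ∀ (γ : ℝ → M) (a b : ℝ),
    PiecewiseSmoothOnWith S.FutureCausal γ a b → γ a ∈ V → γ b ∈ V → ∀ t ∈ Icc a b, γ t ∈ U

/-- The filter on `ℝ` of `t → b`, `t < b`, where `b = ∞` is allowed. -/
noncomputable def endFilter (b : EReal) : Filter ℝ := comap (fun t : ℝ => (t : EReal)) (𝓝[<] b)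

/-- `γ : [a, b) → M` (`b` finite or `∞`) is a curve with all velocities in `C`, piecewise smooth
on each compact subinterval. The values of `γ` outside `[a, b)` are irrelevant. -/
def IsCurveWith (C : ∀ x : M, TangentSpace (𝓡 n) x → Prop) (γ : ℝ → M) (a : ℝ) (b : EReal) :
    Prop :=
  (a : EReal) < b ∧ ∀ c : ℝ, a < c → (c : EReal) < b → PiecewiseSmoothOnWith C γ a c

/-- `γ : [a, b) → M` cannot be extended continuously to `b`. -/
def Inextensible (γ : ℝ → M) (b : EReal) : Prop :=
  ¬ ∃ p : M, Tendsto γ (endFilter b) (𝓝 p)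

end Spacetime

end Spacetimes

end CBoundary

/-! ### Chronological relations on a topological space -/

namespace CBoundary

section AbstractChronology

variable {X : Type*} {r : X → X → Prop}

/-! ## Past sets -/

/-! The proof separates order from geometry. The order-theoretic half uses only the properties
collected in `Chronology`: transitivity, open pasts and futures, approximation of each point from
both sides, convex neighbourhoods (strong causality), and local push-up. Push-up means that for `q`,
`q'` near a common point with `(q, q')` in the closure of ≪, one has I⁺(q') ⊆ I⁺(q) and I⁻(q) ⊆
I⁻(q'). The closure of ≪ thus replaces the causal relation, and no geodesics are needed.

IPs are exactly the pasts of chains (`directed_of_isIP`, `exists_chain`, `isIP_past_range`). A chain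
in the completion determines a chain in M whose past P is the limit of the past components. Such a
sequence converges to every pair with first component P (`Converges.isLimitComponent`), and a
completion contains such a pair. This yields limits of chains, limits of inextensible curves (their
pasts are TIPs) and density. Continuity of the inclusion comes from push-up, and the embedding
property from diamonds. The sets I^±((P,F)) are open because a point of F ∩ P' persists along a
sequence with limit (P',F'). Points are closed because the S-relation admits an empty component only
when no partner exists. The boundary is closed because a pair caught in a small diamond with compact
surroundings is the pair of a point (`isClosed_boundary`).

The geometric half proves `Chronology` for a strongly causal spacetime. Openness follows from short
segments in charts (`exists_segment_chr`). Push-up follows by moving a whole timelike curve with an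
affine map of a chart close to the identity. Since the metric is locally Lipschitz there, tilting
every velocity by a small multiple of a timelike vector compensates for the change of base point
(`exists_pushed_timelike`). Future and past versions are exchanged by reversing the relation or the
time orientation. -/

@[simp] theorem mem_past_singleton {p x : X} : x ∈ past r {p} ↔ r x p := by simp [past]

@[simp] theorem mem_future_singleton {p x : X} : x ∈ future r {p} ↔ r p x := by
  simp [future, past, Function.swap]

theorem IsPastSet.mem_of_rel {P : Set X} (hP : IsPastSet r P) {x y : X} (hy : y ∈ P)
    (h : r x y) : x ∈ P := by
  rw [← hP]; exact ⟨y, hy, h⟩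

theorem IsPastSet.exists_rel {P : Set X} (hP : IsPastSet r P) {x : X} (hx : x ∈ P) :
    ∃ y ∈ P, r x y := by
  rw [← hP] at hx; exact hx

theorem isPastSet_empty : IsPastSet r ∅ := by simp [IsPastSet, past]

/-- A common successor of a point outside `A` and a point outside `B` lies in one of these past sets
and drags the corresponding point into it. -/
theorem isIP_of_directed {P : Set X} (hne : P.Nonempty) (hP : IsPastSet r P)
    (hd : ∀ x ∈ P, ∀ y ∈ P, ∃ z ∈ P, r x z ∧ r y z) : IsIP r P := by
  refine ⟨hne, hP, ?_⟩
  rintro ⟨A, B, hA, hB, hAP, hBP, rfl⟩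
  obtain ⟨a, ha, ha'⟩ := exists_of_ssubset hAP
  obtain ⟨b, hb, hb'⟩ := exists_of_ssubset hBP
  obtain ⟨z, hz, haz, hbz⟩ := hd a ha b hb
  rcases hz with hz | hz
  · exact ha' (hA.mem_of_rel hz haz)
  · exact hb' (hB.mem_of_rel hz hbz)

/-- `(q, q')` belongs to the closure of the relation `r`. -/
def ClosureRel [TopologicalSpace X] (r : X → X → Prop) (q q' : X) : Prop :=
  ∀ W ∈ 𝓝 q, ∀ W' ∈ 𝓝 q', ∃ w ∈ W, ∃ w' ∈ W', r w w'

/-- The properties of the chronological relation of a strongly causal spacetime from which the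
properties of its causal completions follow. -/
structure Chronology [TopologicalSpace X] (r : X → X → Prop) : Prop where
  trans : ∀ {x y z : X}, r x y → r y z → r x z
  isOpen_past : ∀ p, IsOpen {q | r q p}
  isOpen_future : ∀ p, IsOpen {q | r p q}
  exists_past : ∀ p, ∀ U ∈ 𝓝 p, ∃ q ∈ U, r q p
  exists_future : ∀ p, ∀ U ∈ 𝓝 p, ∃ q ∈ U, r p q
  convex : ∀ p, ∀ U ∈ 𝓝 p, ∃ V ∈ 𝓝 p, ∀ x ∈ V, ∀ z ∈ V, ∀ y, r x y → r y z → y ∈ U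
  push_future : ∀ p, ∃ V ∈ 𝓝 p, ∀ q ∈ V, ∀ q' ∈ V, ClosureRel r q q' → ∀ z, r q' z → r q z
  push_past : ∀ p, ∃ V ∈ 𝓝 p, ∀ q ∈ V, ∀ q' ∈ V, ClosureRel r q q' → ∀ z, r z q → r z q'

namespace Chronology

variable [TopologicalSpace X]

theorem swap (C : Chronology r) : Chronology (Function.swap r) where
  trans h h' := C.trans h' h
  isOpen_past := C.isOpen_future
  isOpen_future := C.isOpen_past
  exists_past := C.exists_future
  exists_future := C.exists_past
  convex p U hU := by
    obtain ⟨V, hV, h⟩ := C.convex p U hU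
    exact ⟨V, hV, fun x hx z hz y h₁ h₂ => h z hz x hx y h₂ h₁⟩
  push_future p := by
    obtain ⟨V, hV, h⟩ := C.push_past p
    refine ⟨V, hV, fun q hq q' hq' hc z hz => h q' hq' q hq (fun W hW W' hW' => ?_) z hz⟩
    obtain ⟨w, hw, w', hw', hr⟩ := hc W' hW' W hW
    exact ⟨w', hw', w, hw, hr⟩
  push_past p := by
    obtain ⟨V, hV, h⟩ := C.push_future p
    refine ⟨V, hV, fun q hq q' hq' hc z hz => h q' hq' q hq (fun W hW W' hW' => ?_) z hz⟩
    obtain ⟨w, hw, w', hw', hr⟩ := hc W' hW' W hW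
    exact ⟨w', hw', w, hw, hr⟩

theorem exists_between (C : Chronology r) {x z : X} (h : r x z) : ∃ y, r x y ∧ r y z :=
  C.exists_past z _ ((C.isOpen_future x).mem_nhds h)

theorem isPastSet_past (C : Chronology r) (S : Set X) : IsPastSet r (past r S) := by
  ext x
  constructor
  · rintro ⟨y, ⟨z, hz, hyz⟩, hxy⟩
    exact ⟨z, hz, C.trans hxy hyz⟩
  · rintro ⟨z, hz, hxz⟩
    obtain ⟨y, hxy, hyz⟩ := C.exists_between hxz
    exact ⟨y, ⟨z, hz, hyz⟩, hxy⟩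

theorem isIP_past_singleton (C : Chronology r) (p : X) : IsIP r (past r {p}) := by
  refine isIP_of_directed ?_ (C.isPastSet_past _) fun x hx y hy => ?_
  · obtain ⟨q, -, hq⟩ := C.exists_past p univ univ_mem
    exact ⟨q, by simpa using hq⟩
  · obtain ⟨z, hz, hzp⟩ := C.exists_past p ({q | r x q} ∩ {q | r y q})
      (((C.isOpen_future x).inter (C.isOpen_future y)).mem_nhds
        ⟨by simpa using hx, by simpa using hy⟩)
    exact ⟨z, by simpa using hzp, hz.1, hz.2⟩

/-- Indecomposable past sets are directed. -/
theorem directed_of_isIP (C : Chronology r) {P : Set X} (hP : IsIP r P) {x y : X} (hx : x ∈ P)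
    (hy : y ∈ P) : ∃ z ∈ P, r x z ∧ r y z := by
  obtain ⟨-, hpast, hind⟩ := hP
  by_contra! hno
  -- If `x` and `y` had no common successor in `P`, then `A` would miss `y` and `B` would miss the
  -- points of `P` above `x`, although these two past sets cover `P`.
  set A := past r (P ∩ {q | r x q}) with hA
  set B := past r (P \ A) with hB
  have hAP : A ⊆ P := fun a ⟨b, hb, hab⟩ => hpast.mem_of_rel hb.1 hab
  have hBP : B ⊆ P := fun a ⟨b, hb, hab⟩ => hpast.mem_of_rel hb.1 hab
  have hAne : A ≠ P := by
    rintro h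
    rw [← h] at hy
    obtain ⟨z, hz, hyz⟩ := hy
    exact hno z hz.1 hz.2 hyz
  have hBne : B ≠ P := by
    intro h
    obtain ⟨x₁, hx₁, hxx₁⟩ := hpast.exists_rel hx
    rw [← h] at hx₁
    obtain ⟨w, ⟨hwP, hwA⟩, hx₁w⟩ := hx₁
    obtain ⟨w', hw', hww'⟩ := hpast.exists_rel hwP
    exact hwA ⟨w', ⟨hw', C.trans hxx₁ (C.trans hx₁w hww')⟩, hww'⟩
  refine hind ⟨A, B, C.isPastSet_past _, C.isPastSet_past _, hAP.ssubset_of_ne hAne,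
    hBP.ssubset_of_ne hBne, (union_subset hAP hBP).antisymm fun q hq => ?_⟩
  obtain ⟨q', hq', hqq'⟩ := hpast.exists_rel hq
  by_cases h : q' ∈ A
  · exact Or.inl ((C.isPastSet_past _).mem_of_rel h hqq')
  · exact Or.inr ⟨q', ⟨hq', h⟩, hqq'⟩

theorem rel_of_lt (C : Chronology r) {c : ℕ → X} (hc : ∀ n, r (c n) (c (n + 1))) {m n : ℕ}
    (h : m < n) : r (c m) (c n) := by
  induction n, h using Nat.le_induction with
  | base => exact hc m
  | succ k _ ih => exact C.trans ih (hc k)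

/-- The past of a chain is an IP. -/
theorem isIP_past_range (C : Chronology r) {c : ℕ → X} (hc : ∀ n, r (c n) (c (n + 1))) :
    IsIP r (past r (range c)) := by
  refine isIP_of_directed ⟨c 0, c 1, mem_range_self _, hc 0⟩ (C.isPastSet_past _) ?_
  rintro x ⟨_, ⟨m, rfl⟩, hx⟩ y ⟨_, ⟨n, rfl⟩, hy⟩
  refine ⟨c (max m n + 1), ⟨_, mem_range_self _, hc _⟩, C.trans hx (C.rel_of_lt hc ?_),
    C.trans hy (C.rel_of_lt hc ?_)⟩ <;> omega

/-- Every IP is the past of a chain. -/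
theorem exists_chain [SecondCountableTopology X] (C : Chronology r) {P : Set X}
    (hP : IsIP r P) : ∃ c : ℕ → X, (∀ n, c n ∈ P) ∧ (∀ n, r (c n) (c (n + 1))) ∧
      ∀ x ∈ P, ∀ᶠ n in atTop, r x (c n) := by
  obtain ⟨D, hDc, hD⟩ := TopologicalSpace.exists_countable_dense P
  have hne : Nonempty P := hP.1.to_subtype
  obtain ⟨d, rfl⟩ := hDc.exists_eq_range hD.nonempty
  choose f hfP hf using fun x y : P => C.directed_of_isIP hP x.2 y.2
  -- Each term dominates its predecessor and one more point of the dense sequence. For `x` in `P`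
  -- the open set I⁺(x) meets `P`, hence contains some `d n`, so the chain eventually passes `x`.
  obtain ⟨c, hcs⟩ : ∃ c : ℕ → P, ∀ n, c (n + 1) = ⟨f (c n) (d n), hfP _ _⟩ :=
    ⟨fun n => Nat.rec (d 0) (fun n y => ⟨f y (d n), hfP _ _⟩) n, fun _ => rfl⟩
  have hc : ∀ n, r (c n : X) (c (n + 1) : X) := fun n => by rw [hcs]; exact (hf (c n) (d n)).1
  have hd : ∀ n, r (d n : X) (c (n + 1) : X) := fun n => by rw [hcs]; exact (hf (c n) (d n)).2
  refine ⟨fun n => c n, fun n => (c n).2, hc, fun x hx => ?_⟩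
  obtain ⟨y, hy, hxy⟩ := hP.2.1.exists_rel hx
  obtain ⟨_, hz, n, rfl⟩ := hD.inter_open_nonempty (Subtype.val ⁻¹' {q | r x q})
    ((C.isOpen_future x).preimage continuous_subtype_val) ⟨⟨y, hy⟩, hxy⟩
  filter_upwards [eventually_gt_atTop (n + 1)] with m hm
  exact C.trans hz (C.trans (hd n) (C.rel_of_lt (c := fun n => c n) hc hm))

/-- Strong causality makes the space past distinguishing. -/
theorem eq_of_past_eq [T2Space X] (C : Chronology r) {p q : X} (h : past r {p} = past r {q}) :
    p = q := by
  have h' : ∀ x, r x p ↔ r x q := fun x => by simpa using Set.ext_iff.1 h x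
  by_contra hne
  obtain ⟨U, W, hU, hW, hp, hq, hd⟩ := t2_separation hne
  obtain ⟨V, hV, hc⟩ := C.convex p U (hU.mem_nhds hp)
  obtain ⟨y, hyV, hyp⟩ := C.exists_past p V hV
  -- This `z` is near `q`. As the pasts agree it also lies between `y` and `p`, so convexity puts it
  -- near `p`.
  obtain ⟨z, ⟨hzW, hyz⟩, hzq⟩ := C.exists_past q (W ∩ {x | r y x})
    (inter_mem (hW.mem_nhds hq) ((C.isOpen_future y).mem_nhds ((h' y).1 hyp)))
  exact hd.le_bot ⟨hc y hyV p (mem_of_mem_nhds hV) z hyz ((h' z).2 hzq), hzW⟩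

/-- An IP between two nearby points inside a compact set is the past of a point. -/
theorem exists_eq_past_singleton [SecondCountableTopology X] (C : Chronology r) {P K V : Set X}
    (hP : IsIP r P) (hK : IsCompact K) (hKV : K ⊆ V)
    (hV : ∀ q ∈ V, ∀ q' ∈ V, ClosureRel r q q' → ∀ z, r z q → r z q')
    {y z : X} (hy : y ∈ P) (hz : ∀ x ∈ P, r x z) (hyz : ∀ x, r y x → r x z → x ∈ K) :
    ∃ q ∈ K, P = past r {q} := by
  -- The generating chain ends up in `K`, and a cluster point `q` is the required point. Each `(c n,
  -- q)` is in the closure of the relation, so push-up gives `P` ⊆ I⁻(q); openness of futures gives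
  -- the converse.
  obtain ⟨c, hcP, hc, hPc⟩ := C.exists_chain hP
  have hcK : ∀ᶠ n in atTop, c n ∈ K := by
    filter_upwards [hPc y hy] with n hn using hyz _ hn (hz _ (hcP n))
  obtain ⟨q, hqK, hq⟩ := hK.exists_mapClusterPt_of_frequently hcK.frequently
  refine ⟨q, hqK, subset_antisymm (fun x hx => ?_) fun x hx => ?_⟩
  · obtain ⟨n, hn, hxn⟩ := (hcK.and (hPc x hx)).exists
    refine mem_past_singleton.2 (hV _ (hKV hn) q (hKV hqK) (fun W hW W' hW' => ?_) x hxn)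
    obtain ⟨m, hm, hm'⟩ := ((hq.frequently hW').and_eventually (eventually_gt_atTop n)).exists
    exact ⟨c n, mem_of_mem_nhds hW, c m, hm, C.rel_of_lt hc hm'⟩
  · obtain ⟨m, hm⟩ := (hq.frequently ((C.isOpen_future x).mem_nhds
      (mem_past_singleton.1 hx))).exists
    exact hP.2.1.mem_of_rel (hcP m) hm

end Chronology

/-! ## The limit operator, one component at a time -/

/-- The condition on the past component in the definition of the limit operator. -/
def IsLimitComponent (r : X → X → Prop) (A : ℕ → Set X) (P : Set X) : Prop :=
  P.Nonempty → P ⊆ liminf A atTop ∧ IsMaximalIP r (limsup A atTop) P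

/-- The sequences of sets `A` and `B` behave like the pasts and futures of the points of a chain
whose past is the IP `P`. -/
structure Converges (r : X → X → Prop) (A B : ℕ → Set X) (P : Set X) : Prop where
  isIP : IsIP r P
  mem_left : ∀ x ∈ P, ∀ᶠ n in atTop, x ∈ A n
  left_subset : ∀ᶠ n in atTop, A n ⊆ P
  rel_right : ∀ x ∈ P, ∀ᶠ n in atTop, ∀ y ∈ B n, r x y
  mem_right : ∀ᶠ n in atTop, ∀ y, (∀ x ∈ P, r x y) → y ∈ B n

theorem SRel.swap {P F : Set X} (h : SRel r P F) : SRel (Function.swap r) F P := by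
  rcases h with h | ⟨h₁, h₂, h₃⟩ | ⟨h₁, h₂, h₃⟩
  · exact Or.inl ⟨h.2, h.1⟩
  · exact Or.inr (Or.inr ⟨h₂, h₁, fun ⟨F', hF'⟩ => h₃ ⟨F', hF'.2, hF'.1⟩⟩)
  · exact Or.inr (Or.inl ⟨h₂, h₁, fun ⟨F', hF'⟩ => h₃ ⟨F', hF'.2, hF'.1⟩⟩)

theorem SRel.sRelNonempty {P F : Set X} (h : SRel r P F) (hP : P.Nonempty) (hF : F.Nonempty) :
    SRelNonempty r P F := by
  rcases h with h | ⟨-, rfl, -⟩ | ⟨rfl, -, -⟩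
  · exact h
  · exact absurd hF not_nonempty_empty
  · exact absurd hP not_nonempty_empty

theorem SRel.nonempty_or {P F : Set X} (h : SRel r P F) : P.Nonempty ∨ F.Nonempty := by
  rcases h with h | ⟨h, -, -⟩ | ⟨-, h, -⟩
  · exact Or.inl h.2.1.1.1
  · exact Or.inl h.1
  · exact Or.inr h.1

theorem SRel.isIP {P F : Set X} (h : SRel r P F) (hP : P.Nonempty) : IsIP r P := by
  rcases h with h | ⟨h, -, -⟩ | ⟨rfl, -, -⟩
  · exact h.2.1.1
  · exact h
  · exact absurd hP not_nonempty_empty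

theorem SRel.isPastSet {P F : Set X} (h : SRel r P F) : IsPastSet r P := by
  rcases P.eq_empty_or_nonempty with rfl | hP
  · exact isPastSet_empty
  · exact (h.isIP hP).2.1

variable [TopologicalSpace X]

theorem Chronology.rel_of_mem_commonFuture (C : Chronology r) {P : Set X} {x y : X} (hx : x ∈ P)
    (hy : y ∈ commonFuture r P) : r x y := by
  obtain ⟨z, hz, hzy⟩ := hy
  exact C.trans (hz x hx) hzy

theorem SRel.rel (C : Chronology r) {P F : Set X} (h : SRel r P F) {x y : X} (hx : x ∈ P)
    (hy : y ∈ F) : r x y :=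
  C.rel_of_mem_commonFuture hx ((h.sRelNonempty ⟨x, hx⟩ ⟨y, hy⟩).1.1.2 hy)

/-- The limsup of `A` is `P` itself. An IF inside the limsup of `B` lies above all of `P`, hence in
↑P, where `F` is already maximal. Maximality of `P` in ↓F plays no role. -/
theorem Converges.isLimitComponent (C : Chronology r) {A B : ℕ → Set X} {P F : Set X}
    (h : Converges r A B P) (hPF : SRel r P F) :
    IsLimitComponent r A P ∧ IsLimitComponent (Function.swap r) B F := by
  have h₁ : P ⊆ liminf A atTop := fun x hx => mem_liminf_iff_eventually_mem.2 (h.mem_left x hx)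
  have h₂ : limsup A atTop ⊆ P := fun x hx => by
    obtain ⟨n, hn, hn'⟩ := ((mem_limsup_iff_frequently_mem.1 hx).and_eventually
      h.left_subset).exists
    exact hn' hn
  have h₃ : liminf A atTop ⊆ limsup A atTop := liminf_le_limsup
  refine ⟨fun _ => ⟨h₁, ⟨h.isIP, h₁.trans h₃⟩, fun Q hQ _ => hQ.2.trans h₂⟩, fun hF => ?_⟩
  have hmax := (hPF.sRelNonempty h.isIP.1 hF).1
  have h₄ : F ⊆ liminf B atTop := fun y hy => by
    rw [mem_liminf_iff_eventually_mem]
    filter_upwards [h.mem_right] with n hn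
    exact hn y fun x hx => hPF.rel C hx hy
  refine ⟨h₄, ⟨hmax.1.1, h₄.trans liminf_le_limsup⟩, fun Q hQ hFQ => hmax.2 ⟨hQ.1, ?_⟩ hFQ⟩
  intro y hy
  obtain ⟨z, hz, hzy⟩ := hQ.1.2.1.exists_rel hy
  refine ⟨z, fun x hx => ?_, hzy⟩
  obtain ⟨n, hn, hn'⟩ := ((mem_limsup_iff_frequently_mem.1 (hQ.2 hz)).and_eventually
    (h.rel_right x hx)).exists
  exact hn' z hn

/-- Points `c n` chosen in `B n ∩ A (n + 1)` form a chain in `X`, and its past is the limit. -/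
theorem Chronology.converges_of_chain (C : Chronology r) {A B : ℕ → Set X}
    (hA : ∀ n, IsPastSet r (A n)) (hB : ∀ n, IsPastSet (Function.swap r) (B n))
    (hAB : ∀ n, ∀ x ∈ A n, ∀ y ∈ B n, r x y) (h : ∀ n, (B n ∩ A (n + 1)).Nonempty) :
    ∃ P, Converges r A B P := by
  choose c hcB hcA using h
  have hc : ∀ n, r (c n) (c (n + 1)) := fun n => hAB _ _ (hcA n) _ (hcB (n + 1))
  have hmem : ∀ x ∈ past r (range c), ∀ᶠ n in atTop, r x (c n) ∧ x ∈ A n := by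
    rintro x ⟨_, ⟨m, rfl⟩, hx⟩
    filter_upwards [eventually_gt_atTop (m + 1)] with n hn
    -- The shift is needed because `c k` lies in `A (k + 1)`.
    obtain ⟨k, rfl⟩ : ∃ k, n = k + 1 := ⟨n - 1, by omega⟩
    have hk : r x (c k) := C.trans hx (C.rel_of_lt hc (by omega))
    exact ⟨C.trans hk (hc k), (hA _).mem_of_rel (hcA k) hk⟩
  refine ⟨past r (range c), C.isIP_past_range hc, fun x hx => (hmem x hx).mono fun _ h => h.2,
    Eventually.of_forall fun n x hx => ⟨c n, mem_range_self n, hAB n x hx _ (hcB n)⟩,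
    fun x hx => (hmem x hx).mono fun n h y hy => hAB n x h.2 y hy,
    Eventually.of_forall fun n y hy => ?_⟩
  exact (hB n).mem_of_rel (hcB n) (hy _ ⟨_, mem_range_self _, hc n⟩)

/-- Along a convergent sequence, the pasts of the points converge to the past of the limit. -/
theorem Chronology.isLimitComponent_of_tendsto (C : Chronology r) {p : ℕ → X} {p₀ : X}
    (hp : Tendsto p atTop (𝓝 p₀)) :
    IsLimitComponent r (fun n => past r {p n}) (past r {p₀}) := by
  intro _
  have h₁ : past r {p₀} ⊆ liminf (fun n => past r {p n}) atTop := fun x hx => by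
    rw [mem_liminf_iff_eventually_mem]
    filter_upwards [hp.eventually ((C.isOpen_future x).mem_nhds (mem_past_singleton.1 hx))]
      with n hn using mem_past_singleton.2 hn
  refine ⟨h₁, ⟨C.isIP_past_singleton p₀, h₁.trans liminf_le_limsup⟩, fun Q hQ hpQ x hx => ?_⟩
  -- Maximality: for `x` in a larger IP `Q`, directedness gives `z` in `Q` above `x` and above some
  -- `y` close to `p₀`. Infinitely often `z` lies between `y` and `p n`, so it is near `p₀`, and
  -- `(z, p₀)` is in the closure of the relation. Push-up turns `r x z` into `r x p₀`.
  obtain ⟨V, hV, hpush⟩ := C.push_past p₀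
  obtain ⟨V', hV', hconv⟩ := C.convex p₀ V hV
  obtain ⟨y, hyV, hyp⟩ := C.exists_past p₀ V' hV'
  obtain ⟨z, hzQ, hxz, hyz⟩ := C.directed_of_isIP hQ.1 hx (hpQ (mem_past_singleton.2 hyp))
  have hz : ∃ᶠ n in atTop, r z (p n) := by
    refine (mem_limsup_iff_frequently_mem.1 (hQ.2 hzQ)).mono fun n hn => by simpa using hn
  obtain ⟨n, hzn, hn⟩ := (hz.and_eventually (hp hV')).exists
  refine mem_past_singleton.2 (hpush z (hconv y hyV _ hn z hyz hzn) p₀ (mem_of_mem_nhds hV)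
    (fun W hW W' hW' => ?_) x hxz)
  obtain ⟨m, hzm, hm⟩ := (hz.and_eventually (hp hW')).exists
  exact ⟨z, mem_of_mem_nhds hW, p m, hm, hzm⟩

end AbstractChronology

end CBoundary

/-! ### Topology of the completion -/

namespace CBoundary

namespace AdmissibleCompletion

variable {X : Type*} {r : X → X → Prop} {Mbar : AdmissibleCompletion r}

/-! ## The chronological topology -/

theorem mem_limitOp_iff {σ : ℕ → Mbar.Point} {x : Mbar.Point} :
    x ∈ limitOp σ ↔ IsLimitComponent r (fun n => (σ n).P) x.P ∧
      IsLimitComponent (Function.swap r) (fun n => (σ n).F) x.F := Iff.rfl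

theorem Point.sRel (x : Mbar.Point) : SRel r x.P x.F := Mbar.sRel x.1 x.2

theorem isClosed_iff_limitOp {C : Set Mbar.Point} :
    IsClosed C ↔ ∀ σ : ℕ → Mbar.Point, (∀ n, σ n ∈ C) → limitOp σ ⊆ C := by
  rw [← isOpen_compl_iff]
  change Cᶜᶜ ∈ {C | ∀ σ : ℕ → Mbar.Point, (∀ n, σ n ∈ C) → limitOp σ ⊆ C} ↔ _
  rw [compl_compl]
  rfl

/-- A subsequence avoiding an open neighbourhood of `x` would still have `x` in its limit set,
against closedness of the complement. -/
theorem tendsto_of_mem_limitOp {σ : ℕ → Mbar.Point} {x : Mbar.Point} (hx : x ∈ limitOp σ) :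
    Tendsto σ atTop (𝓝 x) := by
  rw [tendsto_nhds]
  intro U hU hxU
  by_contra hne
  obtain ⟨φ, hφ, hm⟩ := extraction_of_frequently_atTop (not_eventually.1 hne)
  exact isClosed_iff_limitOp.1 hU.isClosed_compl _ hm (limitOp_subset_comp σ hφ hx) hxU

theorem Point.ext {x y : Mbar.Point} (h₁ : x.P = y.P) (h₂ : x.F = y.F) : x = y :=
  Subtype.ext (Prod.ext h₁ h₂)

/-- Maximality forces each nonempty component of `y` to agree with that of `x`. An empty component
of `y` opposite a nonempty one of `x` would give the other component of `y` an S-partner, which the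
S-relation with ∅ excludes. -/
theorem eq_of_mem_limitOp_const {x y : Mbar.Point} (h : y ∈ limitOp fun _ : ℕ => x) : y = x := by
  rw [mem_limitOp_iff] at h
  simp only [IsLimitComponent, liminf_const, limsup_const] at h
  obtain ⟨h₁, h₂⟩ := h
  have hP : y.P.Nonempty → y.P = x.P := fun hy =>
    (h₁ hy).1.antisymm ((h₁ hy).2.2 ⟨x.sRel.isIP (hy.mono (h₁ hy).1), subset_rfl⟩ (h₁ hy).1)
  have hF : y.F.Nonempty → y.F = x.F := fun hy =>
    (h₂ hy).1.antisymm ((h₂ hy).2.2 ⟨x.sRel.swap.isIP (hy.mono (h₂ hy).1), subset_rfl⟩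
      (h₂ hy).1)
  rcases y.P.eq_empty_or_nonempty with hyP | hyP
  · have hyF : y.F.Nonempty := y.sRel.nonempty_or.resolve_left (by simp [hyP])
    rcases x.P.eq_empty_or_nonempty with hxP | hxP
    · exact Point.ext (hyP.trans hxP.symm) (hF hyF)
    · rcases y.sRel with h | ⟨h, -, -⟩ | ⟨-, -, h⟩
      · exact absurd h.2.1.1.1 (by simp [hyP])
      · exact absurd h.1 (by simp [hyP])
      · refine absurd ⟨x.P, ?_⟩ h
        rw [hF hyF]
        exact x.sRel.sRelNonempty hxP (hF hyF ▸ hyF)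
  · rcases y.F.eq_empty_or_nonempty with hyF | hyF
    · rcases x.F.eq_empty_or_nonempty with hxF | hxF
      · exact Point.ext (hP hyP) (hyF.trans hxF.symm)
      · rcases y.sRel with h | ⟨-, -, h⟩ | ⟨-, h, -⟩
        · exact absurd h.1.1.1.1 (by simp [hyF])
        · refine absurd ⟨x.F, ?_⟩ h
          rw [hP hyP]
          exact x.sRel.sRelNonempty (hP hyP ▸ hyP) hxF
        · exact absurd h.1 (by simp [hyF])
    · exact Point.ext (hP hyP) (hF hyF)

theorem t1Space : T1Space Mbar.Point where
  t1 x := isClosed_iff_limitOp.2 fun σ hσ y hy => by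
    obtain rfl : σ = fun _ => x := funext hσ
    exact eq_of_mem_limitOp_const hy

theorem isOpen_future (x : Mbar.Point) : IsOpen {y : Mbar.Point | x.Chr y} := by
  rw [← isClosed_compl_iff, isClosed_iff_limitOp]
  rintro σ hσ y hy ⟨a, haF, haP⟩
  have ha := (hy.1 ⟨a, haP⟩).1 haP
  obtain ⟨n, hn⟩ := (mem_liminf_iff_eventually_mem.1 ha).exists
  exact hσ n ⟨a, haF, hn⟩

theorem isOpen_past (x : Mbar.Point) : IsOpen {y : Mbar.Point | y.Chr x} := by
  rw [← isClosed_compl_iff, isClosed_iff_limitOp]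
  rintro σ hσ y hy ⟨a, haF, haP⟩
  have ha := (hy.2 ⟨a, haF⟩).1 haF
  obtain ⟨n, hn⟩ := (mem_liminf_iff_eventually_mem.1 ha).exists
  exact hσ n ⟨a, hn, haP⟩

/-! ## Limits of chains -/

theorem exists_P_eq {P : Set X} (hP : IsIP r P) : ∃ x : Mbar.Point, x.P = P := by
  by_cases h : ∃ p, P = past r {p}
  · obtain ⟨p, rfl⟩ := h
    exact ⟨Mbar.incl p, rfl⟩
  · obtain ⟨F, hF, -⟩ := Mbar.tip_complete P ⟨hP, h⟩
    exact ⟨⟨(P, F), hF⟩, rfl⟩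

theorem exists_F_eq {F : Set X} (hF : IsIF r F) : ∃ x : Mbar.Point, x.F = F := by
  by_cases h : ∃ p, F = future r {p}
  · obtain ⟨p, rfl⟩ := h
    exact ⟨Mbar.incl p, rfl⟩
  · obtain ⟨P, hP, -⟩ := Mbar.tif_complete F ⟨hF, h⟩
    exact ⟨⟨(P, F), hP⟩, rfl⟩

theorem mem_range_incl_iff {x : Mbar.Point} : x ∈ range Mbar.incl ↔ x.1 ∈ range (pointPair r) :=
  ⟨fun ⟨p, hp⟩ => ⟨p, congrArg Subtype.val hp⟩, fun ⟨p, hp⟩ => ⟨p, Subtype.ext hp⟩⟩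

theorem exists_mem_boundary_P_eq {P : Set X} (hP : IsTIP r P) :
    ∃ x ∈ Mbar.boundary, x.P = P := by
  obtain ⟨F, hF, hF'⟩ := Mbar.tip_complete P hP
  exact ⟨⟨(P, F), hF⟩, fun h => hF' (mem_range_incl_iff.1 h), rfl⟩

theorem exists_mem_boundary_F_eq {F : Set X} (hF : IsTIF r F) :
    ∃ x ∈ Mbar.boundary, x.F = F := by
  obtain ⟨P, hP, hP'⟩ := Mbar.tif_complete F hF
  exact ⟨⟨(P, F), hP⟩, fun h => hP' (mem_range_incl_iff.1 h), rfl⟩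

variable [TopologicalSpace X]

theorem tendsto_of_converges (C : Chronology r) {σ : ℕ → Mbar.Point} {x : Mbar.Point}
    (h : Converges r (fun n => (σ n).P) (fun n => (σ n).F) x.P) : Tendsto σ atTop (𝓝 x) :=
  tendsto_of_mem_limitOp (h.isLimitComponent C x.sRel)

theorem tendsto_of_converges_swap (C : Chronology r) {σ : ℕ → Mbar.Point} {x : Mbar.Point}
    (h : Converges (Function.swap r) (fun n => (σ n).F) (fun n => (σ n).P) x.F) :
    Tendsto σ atTop (𝓝 x) :=
  tendsto_of_mem_limitOp (h.isLimitComponent C.swap x.sRel.swap).symm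

theorem exists_tendsto_of_futureChain (C : Chronology r) {σ : ℕ → Mbar.Point}
    (h : ∀ k, (σ k).Chr (σ (k + 1))) : ∃ x : Mbar.Point, Tendsto σ atTop (𝓝 x) := by
  obtain ⟨P, hP⟩ := C.converges_of_chain (fun n => (σ n).sRel.isPastSet)
    (fun n => (σ n).sRel.swap.isPastSet) (fun n x hx y hy => (σ n).sRel.rel C hx hy) h
  obtain ⟨x, rfl⟩ := exists_P_eq (Mbar := Mbar) hP.isIP
  exact ⟨x, tendsto_of_converges C hP⟩

theorem exists_tendsto_of_pastChain (C : Chronology r) {σ : ℕ → Mbar.Point}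
    (h : ∀ k, (σ (k + 1)).Chr (σ k)) : ∃ x : Mbar.Point, Tendsto σ atTop (𝓝 x) := by
  obtain ⟨F, hF⟩ := C.swap.converges_of_chain (fun n => (σ n).sRel.swap.isPastSet)
    (fun n => (σ n).sRel.isPastSet) (fun n x hx y hy => (σ n).sRel.rel C hy hx)
    (fun n => by rw [inter_comm]; exact h n)
  obtain ⟨x, rfl⟩ := exists_F_eq (Mbar := Mbar) hF.isIP
  exact ⟨x, tendsto_of_converges_swap C hF⟩

/-! ## The inclusion -/

theorem incl_injective [T2Space X] (C : Chronology r) : Function.Injective Mbar.incl :=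
  fun _ _ h => C.eq_of_past_eq (congrArg Point.P h)

theorem continuous_incl [FirstCountableTopology X] (C : Chronology r) :
    Continuous Mbar.incl :=
  continuous_iff_seqContinuous.2 fun _ _ hp => tendsto_of_mem_limitOp
    ⟨C.isLimitComponent_of_tendsto hp, C.swap.isLimitComponent_of_tendsto hp⟩

theorem incl_chr_incl_iff (C : Chronology r) {p q : X} :
    (Mbar.incl p).Chr (Mbar.incl q) ↔ r p q := by
  constructor
  · rintro ⟨x, hpx, hxq⟩
    exact C.trans (mem_future_singleton.1 hpx) (mem_past_singleton.1 hxq)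
  · intro h
    obtain ⟨x, hpx, hxq⟩ := C.exists_between h
    exact ⟨x, mem_future_singleton.2 hpx, mem_past_singleton.2 hxq⟩

/-- By strong causality small diamonds around `p` fit into any neighbourhood, and a diamond is the
trace of an open set I⁺(i(y)) ∩ I⁻(i(z)) of the completion. -/
theorem isEmbedding_incl [T2Space X] [FirstCountableTopology X] (C : Chronology r) :
    IsEmbedding Mbar.incl := by
  refine ⟨isInducing_iff_nhds.2 fun p => le_antisymm
    ((continuous_incl C).tendsto p).le_comap fun U hU => ?_, incl_injective C⟩
  obtain ⟨V, hV, hconv⟩ := C.convex p U hU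
  obtain ⟨y, hyV, hyp⟩ := C.exists_past p V hV
  obtain ⟨z, hzV, hpz⟩ := C.exists_future p V hV
  refine mem_comap.2 ⟨{x | (Mbar.incl y).Chr x} ∩ {x | x.Chr (Mbar.incl z)},
    ((isOpen_future _).inter (isOpen_past _)).mem_nhds
      ⟨(incl_chr_incl_iff C).2 hyp, (incl_chr_incl_iff C).2 hpz⟩, fun x hx => ?_⟩
  exact hconv y hyV z hzV x ((incl_chr_incl_iff C).1 hx.1) ((incl_chr_incl_iff C).1 hx.2)

theorem converges_incl_of_chain (C : Chronology r) {P : Set X} (hP : IsIP r P) {c : ℕ → X}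
    (hcP : ∀ᶠ n in atTop, c n ∈ P) (hc : ∀ x ∈ P, ∀ᶠ n in atTop, r x (c n)) :
    Converges r (fun n => past r {c n}) (fun n => future r {c n}) P where
  isIP := hP
  mem_left x hx := (hc x hx).mono fun _ h => mem_past_singleton.2 h
  left_subset := hcP.mono fun _ h _ hx => hP.2.1.mem_of_rel h (mem_past_singleton.1 hx)
  rel_right x hx := (hc x hx).mono fun _ h _ hy => C.trans h (mem_future_singleton.1 hy)
  mem_right := hcP.mono fun _ h _ hy => mem_future_singleton.2 (hy _ h)

theorem denseRange_incl [SecondCountableTopology X] (C : Chronology r) :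
    DenseRange Mbar.incl := by
  intro x
  rcases x.sRel.nonempty_or with h | h
  · obtain ⟨c, hcP, -, hc⟩ := C.exists_chain (x.sRel.isIP h)
    exact mem_closure_of_tendsto (tendsto_of_converges C (σ := fun n => Mbar.incl (c n))
      (converges_incl_of_chain C (x.sRel.isIP h) (Eventually.of_forall hcP) hc))
      (Eventually.of_forall fun n => mem_range_self _)
  · obtain ⟨c, hcF, -, hc⟩ := C.swap.exists_chain (x.sRel.swap.isIP h)
    exact mem_closure_of_tendsto (tendsto_of_converges_swap C (σ := fun n => Mbar.incl (c n))
      (converges_incl_of_chain C.swap (x.sRel.swap.isIP h) (Eventually.of_forall hcF) hc))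
      (Eventually.of_forall fun n => mem_range_self _)

/-! ## The boundary -/

/-- If boundary points had a limit i(p), their components would eventually contain given `y` ≪ p ≪
`z` whose diamond lies in a small compact set. Then P_n = I⁻(q) and F_n = I⁺(q') by compactness, and
the S-relation forces F_n = I⁺(q), so the pair is i(q). -/
theorem isClosed_boundary [LocallyCompactSpace X] [SecondCountableTopology X]
    (C : Chronology r) : IsClosed Mbar.boundary := by
  refine isClosed_iff_limitOp.2 fun σ hσ x hx => ?_
  rintro ⟨p, rfl⟩
  obtain ⟨V₁, hV₁, hpush₁⟩ := C.push_future p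
  obtain ⟨V₂, hV₂, hpush₂⟩ := C.push_past p
  obtain ⟨V₃, hV₃, hpush₃⟩ := C.swap.push_past p
  obtain ⟨K, hK, hKV, hKc⟩ := local_compact_nhds (inter_mem hV₁ (inter_mem hV₂ hV₃))
  obtain ⟨V, hV, hconv⟩ := C.convex p K hK
  obtain ⟨y, hyV, hyp⟩ := C.exists_past p V hV
  obtain ⟨z, hzV, hpz⟩ := C.exists_future p V hV
  have hy : y ∈ (Mbar.incl p).P := mem_past_singleton.2 hyp
  have hz : z ∈ (Mbar.incl p).F := mem_future_singleton.2 hpz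
  obtain ⟨n, hyn, hzn⟩ := ((mem_liminf_iff_eventually_mem.1 ((hx.1 ⟨y, hy⟩).1 hy)).and
    (mem_liminf_iff_eventually_mem.1 ((hx.2 ⟨z, hz⟩).1 hz))).exists
  have hS := (σ n).sRel
  obtain ⟨q, hqK, hq⟩ := C.exists_eq_past_singleton (hS.isIP ⟨y, hyn⟩) hKc
    (hKV.trans fun _ h => h.2.1) hpush₂ hyn (fun x hx => hS.rel C hx hzn)
    (fun x => hconv y hyV z hzV x)
  obtain ⟨q', hqK', hq'⟩ := C.swap.exists_eq_past_singleton (hS.swap.isIP ⟨z, hzn⟩) hKc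
    (hKV.trans fun _ h => h.2.2) hpush₃ hzn (fun x hx => hS.rel C hyn hx)
    (fun x h₁ h₂ => hconv y hyV z hzV x h₂ h₁)
  -- All of I⁻(q) precedes all of I⁺(q'), so `(q, q')` is in the closure of the relation.
  have hpush : ∀ z, r q' z → r q z := by
    refine hpush₁ q (hKV hqK).1 q' (hKV hqK').1 fun W hW W' hW' => ?_
    obtain ⟨w, hw, hwq⟩ := C.exists_past q W hW
    obtain ⟨w', hw', hwq'⟩ := C.exists_future q' W' hW'
    refine ⟨w, hw, w', hw', hS.rel C ?_ ?_⟩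
    · rw [hq]; exact mem_past_singleton.2 hwq
    · rw [hq']; exact mem_future_singleton.2 hwq'
  have hsub : (σ n).F ⊆ future r {q} := fun w hw => by
    rw [hq'] at hw
    exact mem_future_singleton.2 (hpush w (mem_future_singleton.1 hw))
  have hF : (σ n).F = future r {q} := by
    refine hsub.antisymm ((hS.sRelNonempty ⟨y, hyn⟩ ⟨z, hzn⟩).1.2
      ⟨C.swap.isIP_past_singleton q, fun w hw => ?_⟩ hsub)
    obtain ⟨v, hqv, hvw⟩ := C.exists_between (mem_future_singleton.1 hw)
    refine ⟨v, fun u hu => C.trans (mem_past_singleton.1 (hq ▸ hu)) hqv, hvw⟩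
  exact hσ n ⟨q, (Point.ext hq hF).symm⟩

/-! ## Limits of inextensible curves -/

/-- Any `y` ≪ `p` is eventually below the curve, which itself stays below `p`; convexity then traps
the curve near `p`. -/
theorem tendsto_of_past_image_eq (C : Chronology r) {γ : ℝ → X} {l : Filter ℝ}
    {I : Set ℝ} (hl : ∀ t ∈ I, ∀ᶠ s in l, s ∈ I ∧ t < s)
    (hγ : ∀ s ∈ I, ∀ t ∈ I, s < t → r (γ s) (γ t)) {p : X}
    (hp : past r (γ '' I) = past r {p}) : Tendsto γ l (𝓝 p) := by
  obtain rfl | hl' := l.eq_or_neBot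
  · exact tendsto_bot
  intro U hU
  obtain ⟨V, hV, hconv⟩ := C.convex p U hU
  obtain ⟨y, hyV, hyp⟩ := C.exists_past p V hV
  have hy : y ∈ past r (γ '' I) := hp ▸ mem_past_singleton.2 hyp
  obtain ⟨_, ⟨t, ht, rfl⟩, hyt⟩ := hy
  rw [mem_map]
  filter_upwards [hl t ht] with s hs
  obtain ⟨u, hu⟩ := (hl s hs.1).exists
  have hsp : γ s ∈ past r {p} := hp ▸ ⟨γ u, mem_image_of_mem _ hu.1, hγ s hs.1 u hu.1 hu.2⟩
  exact hconv y hyV p (mem_of_mem_nhds hV) _ (C.trans hyt (hγ t ht s hs.1 hs.2))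
    (mem_past_singleton.1 hsp)

theorem isIP_past_image (C : Chronology r) {γ : ℝ → X} {l : Filter ℝ} [l.NeBot]
    {I : Set ℝ} (hI : I.Nonempty) (hl : ∀ t ∈ I, ∀ᶠ s in l, s ∈ I ∧ t < s)
    (hγ : ∀ s ∈ I, ∀ t ∈ I, s < t → r (γ s) (γ t)) : IsIP r (past r (γ '' I)) := by
  have hmem : ∀ t ∈ I, γ t ∈ past r (γ '' I) := fun t ht => by
    obtain ⟨u, hu⟩ := (hl t ht).exists
    exact ⟨γ u, mem_image_of_mem _ hu.1, hγ t ht u hu.1 hu.2⟩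
  refine isIP_of_directed ⟨_, hmem _ hI.some_mem⟩ (C.isPastSet_past _) ?_
  rintro x ⟨_, ⟨s, hs, rfl⟩, hx⟩ y ⟨_, ⟨t, ht, rfl⟩, hy⟩
  obtain ⟨u, hsu, htu⟩ := ((hl s hs).and (hl t ht)).exists
  exact ⟨γ u, hmem u hsu.1, C.trans hx (hγ s hs u hsu.1 hsu.2),
    C.trans hy (hγ t ht u htu.1 htu.2)⟩

/-- A future-directed chronological curve without a limit generates a TIP, to which it
converges. -/
theorem converges_of_curve (C : Chronology r) {γ : ℝ → X} {l : Filter ℝ}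
    {I : Set ℝ} (hI : I.Nonempty) (hl : ∀ t ∈ I, ∀ᶠ s in l, s ∈ I ∧ t < s)
    (hγ : ∀ s ∈ I, ∀ t ∈ I, s < t → r (γ s) (γ t)) (hlim : ¬ ∃ p, Tendsto γ l (𝓝 p)) :
    ∃ P, IsTIP r P ∧ ∀ t : ℕ → ℝ, Tendsto t atTop l →
      Converges r (fun n => past r {γ (t n)}) (fun n => future r {γ (t n)}) P := by
  obtain rfl | hl' := l.eq_or_neBot
  · exact absurd ⟨γ hI.some, tendsto_bot⟩ hlim
  have hIP := isIP_past_image C hI hl hγ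
  refine ⟨past r (γ '' I), ⟨hIP, fun ⟨p, hp⟩ => hlim ⟨p, tendsto_of_past_image_eq C hl hγ hp⟩⟩,
    fun t ht => converges_incl_of_chain C hIP ?_ ?_⟩
  · obtain ⟨t₀, ht₀⟩ := hI
    filter_upwards [ht.eventually (hl t₀ ht₀)] with n hn
    obtain ⟨u, hu⟩ := (hl _ hn.1).exists
    exact ⟨γ u, mem_image_of_mem _ hu.1, hγ _ hn.1 u hu.1 hu.2⟩
  · rintro x ⟨_, ⟨s, hs, rfl⟩, hx⟩
    filter_upwards [ht.eventually (hl s hs)] with n hn using C.trans hx (hγ s hs _ hn.1 hn.2)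

variable (Mbar)

theorem exists_mem_boundary_tendsto_of_futureCurve (C : Chronology r) {γ : ℝ → X}
    {l : Filter ℝ} [l.IsCountablyGenerated]
    {I : Set ℝ} (hI : I.Nonempty) (hl : ∀ t ∈ I, ∀ᶠ s in l, s ∈ I ∧ t < s)
    (hγ : ∀ s ∈ I, ∀ t ∈ I, s < t → r (γ s) (γ t)) (hlim : ¬ ∃ p, Tendsto γ l (𝓝 p)) :
    ∃ x ∈ Mbar.boundary, Tendsto (fun t => Mbar.incl (γ t)) l (𝓝 x) := by
  obtain ⟨P, hP, hconv⟩ := converges_of_curve C hI hl hγ hlim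
  obtain ⟨x, hx, rfl⟩ := exists_mem_boundary_P_eq (Mbar := Mbar) hP
  exact ⟨x, hx, tendsto_of_seq_tendsto fun t ht => tendsto_of_converges C (hconv t ht)⟩

theorem exists_mem_boundary_tendsto_of_pastCurve (C : Chronology r) {γ : ℝ → X}
    {l : Filter ℝ} [l.IsCountablyGenerated]
    {I : Set ℝ} (hI : I.Nonempty) (hl : ∀ t ∈ I, ∀ᶠ s in l, s ∈ I ∧ t < s)
    (hγ : ∀ s ∈ I, ∀ t ∈ I, s < t → r (γ t) (γ s)) (hlim : ¬ ∃ p, Tendsto γ l (𝓝 p)) :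
    ∃ x ∈ Mbar.boundary, Tendsto (fun t => Mbar.incl (γ t)) l (𝓝 x) := by
  obtain ⟨F, hF, hconv⟩ := converges_of_curve C.swap hI hl hγ hlim
  obtain ⟨x, hx, rfl⟩ := exists_mem_boundary_F_eq (Mbar := Mbar) hF
  exact ⟨x, hx, tendsto_of_seq_tendsto fun t ht => tendsto_of_converges_swap C (hconv t ht)⟩

end AdmissibleCompletion

end CBoundary

/-! ### The metric and timelike curves in charts -/

namespace CBoundary

namespace Spacetime

/-- All tangent spaces are definitionally the model space, so base point and vector can be replaced
separately, without casts. -/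
theorem congr_cone {n : ℕ} {M : Type*} [TopologicalSpace M]
    [ChartedSpace (EuclideanSpace ℝ (Fin n)) M] {C : ∀ x : M, TangentSpace (𝓡 n) x → Prop}
    {x y : M} (h : x = y) {v w : EuclideanSpace ℝ (Fin n)} (hvw : v = w) (hC : C x v) :
    C y w := by
  subst h hvw; exact hC

variable {n : ℕ} {M : Type*} [TopologicalSpace M]
  [ChartedSpace (EuclideanSpace ℝ (Fin n)) M] [IsManifold (𝓡 n) ∞ M] (S : Spacetime n M)

/-! ## The metric in a chart -/

/-- The derivative of the inverse of the chart at `p`. -/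
noncomputable def chartDeriv (n : ℕ) {M : Type*} [TopologicalSpace M]
    [ChartedSpace (EuclideanSpace ℝ (Fin n)) M] (p : M) (y : EuclideanSpace ℝ (Fin n)) :
    EuclideanSpace ℝ (Fin n) →L[ℝ] EuclideanSpace ℝ (Fin n) :=
  mfderiv 𝓘(ℝ, EuclideanSpace ℝ (Fin n)) (𝓡 n) (extChartAt (𝓡 n) p).symm y

/-- The metric in the chart at `p`. -/
noncomputable def chartMetric (p : M) (y : EuclideanSpace ℝ (Fin n)) :
    EuclideanSpace ℝ (Fin n) →L[ℝ] EuclideanSpace ℝ (Fin n) →L[ℝ] ℝ :=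
  letI g : EuclideanSpace ℝ (Fin n) →L[ℝ] EuclideanSpace ℝ (Fin n) →L[ℝ] ℝ :=
    S.g ((extChartAt (𝓡 n) p).symm y)
  g.bilinearComp (chartDeriv n p y) (chartDeriv n p y)

/-- The product with the orienting vector field in the chart at `p`. -/
noncomputable def chartTime (p : M) (y : EuclideanSpace ℝ (Fin n)) :
    EuclideanSpace ℝ (Fin n) →L[ℝ] ℝ :=
  letI g : EuclideanSpace ℝ (Fin n) →L[ℝ] ℝ :=
    S.g ((extChartAt (𝓡 n) p).symm y) (S.orient ((extChartAt (𝓡 n) p).symm y))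
  g.comp (chartDeriv n p y)

theorem futureTimelike_chart_iff (p : M) (y v : EuclideanSpace ℝ (Fin n)) :
    S.FutureTimelike ((extChartAt (𝓡 n) p).symm y) (chartDeriv n p y v) ↔
      S.chartMetric p y v v < 0 ∧ S.chartTime p y v < 0 :=
  and_congr Iff.rfl (iff_of_eq (congrArg (· < 0) (S.symm _ _ _)))

theorem contMDiffOn_chartDeriv (p : M) (v : EuclideanSpace ℝ (Fin n)) :
    ContMDiffOn 𝓘(ℝ, EuclideanSpace ℝ (Fin n)) (𝓡 n).tangent 1
      (fun y => (⟨(extChartAt (𝓡 n) p).symm y, chartDeriv n p y v⟩ : TangentBundle (𝓡 n) M))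
      (extChartAt (𝓡 n) p).target := by
  have : IsManifold (𝓡 n) 1 M := IsManifold.of_le (n := ∞) (by norm_num)
  have hopen := isOpen_extChartAt_target (I := 𝓡 n) p
  have h₁ := (contMDiffOn_extChartAt_symm (I := 𝓡 n) (n := ∞) p).contMDiffOn_tangentMapWithin
    (m := 1) (by norm_num; exact WithTop.coe_le_coe.2 le_top) hopen.uniqueMDiffOn
  have h₂ : ContMDiff 𝓘(ℝ, EuclideanSpace ℝ (Fin n)) 𝓘(ℝ, EuclideanSpace ℝ (Fin n)).tangent 1
      (fun y : EuclideanSpace ℝ (Fin n) =>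
        (⟨y, v⟩ : TangentBundle 𝓘(ℝ, EuclideanSpace ℝ (Fin n)) (EuclideanSpace ℝ (Fin n)))) := by
    intro y
    rw [Bundle.contMDiffAt_totalSpace]
    refine ⟨contMDiffAt_id, ?_⟩
    simp only [trivializationAt_model_space_apply]
    exact contMDiffAt_const
  refine (h₁.comp (h₂.contMDiffOn (s := (extChartAt (𝓡 n) p).target)) fun y hy => hy).congr
    fun y hy => ?_
  simp only [Function.comp_apply, tangentMapWithin, chartDeriv]
  rw [mfderivWithin_of_isOpen hopen hy]
  rfl

theorem contMDiffOn_metric_chart (p : M) :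
    ContMDiffOn 𝓘(ℝ, EuclideanSpace ℝ (Fin n)) ((𝓡 n).prod
      𝓘(ℝ, EuclideanSpace ℝ (Fin n) →L[ℝ] EuclideanSpace ℝ (Fin n) →L[ℝ] ℝ)) 1
      (fun y => Bundle.TotalSpace.mk'
        (EuclideanSpace ℝ (Fin n) →L[ℝ] EuclideanSpace ℝ (Fin n) →L[ℝ] ℝ)
        (E := fun x : M => TangentSpace (𝓡 n) x →L[ℝ] TangentSpace (𝓡 n) x →L[ℝ] ℝ)
        ((extChartAt (𝓡 n) p).symm y) (S.g ((extChartAt (𝓡 n) p).symm y)))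
      (extChartAt (𝓡 n) p).target :=
  (S.contMDiff.comp_contMDiffOn (contMDiffOn_extChartAt_symm p)).of_le (by norm_num)

/-- Class C¹ is what provides the local Lipschitz bound used to move curves; for the time
orientation continuity is enough. -/
theorem contDiffOn_chartMetric (p : M) :
    ContDiffOn ℝ 1 (S.chartMetric p) (extChartAt (𝓡 n) p).target := by
  simp only [contDiffOn_clm_apply]
  intro v w
  have h := ContMDiffOn.clm_bundle_apply₂ (F₁ := EuclideanSpace ℝ (Fin n))
    (F₂ := EuclideanSpace ℝ (Fin n)) (F₃ := ℝ) (E₃ := Bundle.Trivial M ℝ)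
    (S.contMDiffOn_metric_chart p)
    (contMDiffOn_chartDeriv p v) (contMDiffOn_chartDeriv p w)
  rw [← contMDiffOn_iff_contDiffOn]
  intro x hx
  have := h x hx
  simp only [Bundle.contMDiffWithinAt_totalSpace] at this
  exact this.2

theorem continuousOn_chartTime (p : M) :
    ContinuousOn (S.chartTime p) (extChartAt (𝓡 n) p).target := by
  rw [← contDiffOn_zero (𝕜 := ℝ)]
  simp only [contDiffOn_clm_apply]
  intro v
  have hb := contMDiffOn_extChartAt_symm (I := 𝓡 n) (n := ∞) p
  have ho : ContMDiff (𝓡 n) (𝓡 n).tangent 0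
    (fun x => (⟨x, S.orient x⟩ : TangentBundle (𝓡 n) M)) :=
      contMDiff_zero_iff.2 S.orient_continuous
  have h := ContMDiffOn.clm_bundle_apply₂ (F₁ := EuclideanSpace ℝ (Fin n))
    (F₂ := EuclideanSpace ℝ (Fin n)) (F₃ := ℝ) (E₃ := Bundle.Trivial M ℝ)
    ((S.contMDiffOn_metric_chart p).of_le (by norm_num))
    (ho.comp_contMDiffOn (hb.of_le (by norm_num)))
    ((contMDiffOn_chartDeriv p v).of_le (by norm_num))
  rw [← contMDiffOn_iff_contDiffOn]
  intro x hx
  have := h x hx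
  simp only [Bundle.contMDiffWithinAt_totalSpace] at this
  exact this.2

theorem isInvertible_chartDeriv {p : M} {y : EuclideanSpace ℝ (Fin n)}
    (hy : y ∈ (extChartAt (𝓡 n) p).target) :
    (chartDeriv n p y).IsInvertible := by
  have : IsManifold (𝓡 n) 1 M := IsManifold.of_le (n := ∞) (by norm_num)
  have h := isInvertible_mfderivWithin_extChartAt_symm (I := 𝓡 n) hy
  rw [ModelWithCorners.range_eq_univ, mfderivWithin_univ] at h
  exact h

/-! ## Curves in a chart -/

theorem mfderivWithin_chart_symm_comp {p : M} {β : ℝ → EuclideanSpace ℝ (Fin n)} {a b t : ℝ}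
    (hab : a < b) (ht : t ∈ Icc a b) (hβ : DifferentiableWithinAt ℝ β (Icc a b) t)
    (hβT : β t ∈ (extChartAt (𝓡 n) p).target) :
    (mfderivWithin 𝓘(ℝ, ℝ) (𝓡 n) (fun s => (extChartAt (𝓡 n) p).symm (β s)) (Icc a b) t (1 : ℝ) :
      EuclideanSpace ℝ (Fin n)) =
    chartDeriv n p (β t) (derivWithin β (Icc a b) t) := by
  have h := mfderiv_comp_mfderivWithin (I := 𝓘(ℝ, ℝ))
    (I' := 𝓘(ℝ, EuclideanSpace ℝ (Fin n))) (I'' := 𝓡 n) t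
    (g := (extChartAt (𝓡 n) p).symm) (f := β) (s := Icc a b)
    (((contMDiffOn_extChartAt_symm (I := 𝓡 n) (n := ∞) p).contMDiffAt
      ((isOpen_extChartAt_target p).mem_nhds hβT)).mdifferentiableAt (by norm_num))
    hβ.mdifferentiableWithinAt ((uniqueDiffOn_Icc hab t ht).uniqueMDiffWithinAt)
  have h' := congrArg (fun L => L (1 : ℝ)) h
  refine h'.trans ?_
  rw [mfderivWithin_eq_fderivWithin]
  rfl

theorem smoothOnWith_of_chart {C : ∀ x : M, TangentSpace (𝓡 n) x → Prop} {p : M}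
    {β : ℝ → EuclideanSpace ℝ (Fin n)} {a b : ℝ} (hab : a < b)
    (hβ : ContDiffOn ℝ ∞ β (Icc a b)) (hβT : ∀ t ∈ Icc a b, β t ∈ (extChartAt (𝓡 n) p).target)
    (hC : ∀ t ∈ Icc a b, C ((extChartAt (𝓡 n) p).symm (β t))
      (chartDeriv n p (β t) (derivWithin β (Icc a b) t))) :
    SmoothOnWith C (fun t => (extChartAt (𝓡 n) p).symm (β t)) a b := by
  refine ⟨hab, (contMDiffOn_extChartAt_symm p).comp hβ.contMDiffOn hβT, fun t ht => ?_⟩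
  exact congr_cone rfl (mfderivWithin_chart_symm_comp hab ht
    (hβ.differentiableOn (by norm_num) t ht) (hβT t ht)).symm (hC t ht)

theorem SmoothOnWith.chart {C : ∀ x : M, TangentSpace (𝓡 n) x → Prop} {p : M}
    {γ : ℝ → M} {a b : ℝ} (h : SmoothOnWith C γ a b)
    (hγ : ∀ t ∈ Icc a b, γ t ∈ (extChartAt (𝓡 n) p).source) :
    ContDiffOn ℝ ∞ (fun t => extChartAt (𝓡 n) p (γ t)) (Icc a b) ∧
    ∀ t ∈ Icc a b, C ((extChartAt (𝓡 n) p).symm (extChartAt (𝓡 n) p (γ t)))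
      (chartDeriv n p (extChartAt (𝓡 n) p (γ t))
        (derivWithin (fun t => extChartAt (𝓡 n) p (γ t)) (Icc a b) t)) := by
  obtain ⟨hab, hsm, hC⟩ := h
  have hβ : ContDiffOn ℝ ∞ (fun t => extChartAt (𝓡 n) p (γ t)) (Icc a b) := by
    rw [← contMDiffOn_iff_contDiffOn]
    exact (contMDiffOn_extChartAt (I := 𝓡 n) (n := ∞) (x := p)).comp hsm
      (fun t ht => by rw [← extChartAt_source (𝓡 n)]; exact hγ t ht)
  refine ⟨hβ, fun t ht => congr_cone ((extChartAt (𝓡 n) p).left_inv (hγ t ht)).symm ?_ (hC t ht)⟩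
  rw [← mfderivWithin_chart_symm_comp hab ht (hβ.differentiableOn (by norm_num) t ht)
    ((extChartAt (𝓡 n) p).map_source (hγ t ht))]
  congr 1
  exact mfderivWithin_congr (fun s hs => ((extChartAt (𝓡 n) p).left_inv (hγ s hs)).symm)
    ((extChartAt (𝓡 n) p).left_inv (hγ t ht)).symm

end Spacetime

end CBoundary

/-! ### Perturbation of timelike cones -/

namespace CBoundary

/-! ## Cones of a continuous family of Lorentzian products -/

section Cones

variable {E : Type*} [NormedAddCommGroup E] [NormedSpace ℝ E]

/-- If `g v v ≤ 0`, then `o` and `v` span a plane on which `g` is negative semidefinite. It meets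
the hyperplane orthogonal to `e` in a nonzero vector, where `g` is positive. -/
theorem pos_of_orthogonal_timelike {g : E →L[ℝ] E →L[ℝ] ℝ} (hs : ∀ v w, g v w = g w v) {e : E}
    (he : ∀ w, g e w = 0 → w ≠ 0 → 0 < g w w) {o v : E} (ho : g o o < 0) (hov : g o v = 0)
    (hv : v ≠ 0) : 0 < g v v := by
  by_contra! hvv
  have ho0 : o ≠ 0 := by rintro rfl; simp at ho
  have heo : g e o ≠ 0 := fun h => (he o h ho0).not_gt ho
  set w := g e v • o - g e o • v with hw
  have hew : g e w = 0 := by simp [hw]; ring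
  have hw0 : w ≠ 0 := by
    intro h
    have h₁ : g o w = g e v * g o o := by simp [hw, hov]
    rw [h, map_zero] at h₁
    have h₂ : g e v = 0 := by
      rcases mul_eq_zero.1 h₁.symm with h | h
      · exact h
      · exact absurd h ho.ne
    have h₃ : g e o • v = 0 := by simpa [hw, h₂] using h
    rcases smul_eq_zero.1 h₃ with h | h
    · exact heo h
    · exact hv h
  have hww : g w w = (g e v) ^ 2 * g o o + (g e o) ^ 2 * g v v := by
    have := hs v o
    simp [hw, hov, this]; ring
  have h₁ := he w hew hw0
  nlinarith [mul_nonneg (sq_nonneg (g e v)) (neg_nonneg.2 ho.le),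
    mul_nonneg (sq_nonneg (g e o)) (neg_nonneg.2 hvv)]

/-- The function max(g v v, |h v|) is positive on the compact unit sphere; `m` bounds it below, and
homogeneity does the rest. -/
theorem exists_cone_bound [FiniteDimensional ℝ E] {g : E →L[ℝ] E →L[ℝ] ℝ} {h : E →L[ℝ] ℝ}
    (hpos : ∀ v, v ≠ 0 → h v = 0 → 0 < g v v) :
    ∃ m > 0, ∀ v, g v v < m * ‖v‖ ^ 2 → m * ‖v‖ ≤ |h v| := by
  have hcont : Continuous fun v => max (g v v) |h v| := by fun_prop
  obtain ⟨m, hm, hle⟩ := (isCompact_sphere (0 : E) 1).exists_forall_le' (a := 0)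
    hcont.continuousOn fun v hv => by
      have hv0 : v ≠ 0 := by rintro rfl; simp at hv
      by_cases hh : h v = 0
      · exact lt_max_of_lt_left (hpos v hv0 hh)
      · exact lt_max_of_lt_right (abs_pos.2 hh)
  refine ⟨m, hm, fun v hv => ?_⟩
  rcases eq_or_ne v 0 with rfl | hv0
  · simp
  have hn : 0 < ‖v‖ := norm_pos_iff.2 hv0
  have hu := hle (‖v‖⁻¹ • v) (by simp [norm_smul, hn.ne'])
  have h₁ : g (‖v‖⁻¹ • v) (‖v‖⁻¹ • v) < m := by
    have : g (‖v‖⁻¹ • v) (‖v‖⁻¹ • v) = g v v / ‖v‖ ^ 2 := by simp; field_simp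
    rw [this, div_lt_iff₀ (by positivity)]
    exact hv
  have h₂ : m ≤ |h v| / ‖v‖ := by
    rcases le_max_iff.1 hu with h | h
    · exact absurd h h₁.not_ge
    · simpa [abs_mul, div_eq_inv_mul] using h
  exact (le_div_iff₀ hn).1 h₂

theorem apply_apply_le_add (g g' : E →L[ℝ] E →L[ℝ] ℝ) (v w : E) :
    g v w ≤ g' v w + ‖g - g'‖ * ‖v‖ * ‖w‖ := by
  have := (le_abs_self _).trans ((g - g').le_opNorm₂ v w)
  simp only [sub_apply] at this
  linarith

theorem apply_apply_le_add' (g g' : E →L[ℝ] E →L[ℝ] ℝ) (v w : E) :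
    g v w ≤ g' v w + ‖g' - g‖ * ‖v‖ * ‖w‖ := by
  have := (neg_le_abs _).trans ((g' - g).le_opNorm₂ v w)
  simp only [sub_apply] at this
  linarith

theorem apply_le_apply_add (h h' : E →L[ℝ] ℝ) (v : E) :
    h v ≤ h' v + ‖h - h'‖ * ‖v‖ := by
  have := (le_abs_self _).trans ((h - h').le_opNorm v)
  simp only [sub_apply] at this
  linarith

/-- Adding to a timelike vector at `y` a small multiple of a fixed timelike vector yields a vector
that is timelike at every point close enough to `y`, in terms of the multiple. -/
theorem exists_pushed_timelike [FiniteDimensional ℝ E] {G : E → E →L[ℝ] E →L[ℝ] ℝ}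
    {h : E → E →L[ℝ] ℝ} {y₀ o : E} (hG : ContDiffAt ℝ 1 G y₀) (hh : ContinuousAt h y₀)
    (hs : ∀ y v w, G y v w = G y w v) (ho : G y₀ o o < 0) (hho : ∀ v, h y₀ v = G y₀ o v)
    (hpos : ∀ v, v ≠ 0 → G y₀ o v = 0 → 0 < G y₀ v v) :
    ∃ ρ > 0, ∃ κ > 0, ∀ y ∈ Metric.ball y₀ ρ, ∀ y' ∈ Metric.ball y₀ ρ, ∀ δ > 0,
      ‖y' - y‖ ≤ κ * δ → ∀ v, G y v v < 0 → h y v < 0 →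
        G y' (v - (δ * h y₀ v) • o) (v - (δ * h y₀ v) • o) < 0 ∧
          h y' (v - (δ * h y₀ v) • o) < 0 := by
  obtain ⟨m, hm, hbound⟩ := exists_cone_bound (g := G y₀) (h := h y₀)
    fun v hv h0 => hpos v hv (hho v ▸ h0)
  obtain ⟨L, s, hs₀, hL⟩ := hG.exists_lipschitzOnWith
  -- Chosen so that both `η` and `η * ‖o‖` are at most m/2.
  set η : ℝ := m / (2 * (1 + ‖o‖)) with hη
  have hη0 : 0 < η := by positivity
  have hη1 : η ≤ m / 2 := by
    rw [hη]; gcongr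
    linarith [norm_nonneg o]
  have hη2 : η * ‖o‖ ≤ m / 2 := by
    rw [hη, div_mul_eq_mul_div, div_le_div_iff₀ (by positivity) (by norm_num)]
    nlinarith [norm_nonneg o]
  have hGc := hG.continuousAt
  have hGo : ContinuousAt (fun y => G y o o) y₀ := by fun_prop
  have hhoc : ContinuousAt (fun y => h y o) y₀ := by fun_prop
  have hev : ∀ᶠ y in 𝓝 y₀, y ∈ s ∧ ‖G y - G y₀‖ < η ∧ ‖h y - h y₀‖ < η ∧ G y o o < 0 ∧
      h y o < 0 := by
    filter_upwards [hs₀, (Metric.tendsto_nhds.1 hGc η hη0), (Metric.tendsto_nhds.1 hh η hη0),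
      hGo.eventually_lt_const ho, hhoc.eventually_lt_const (u := 0) (by simpa [hho] using ho)] with y h₁ h₂ h₃ h₄ h₅
    exact ⟨h₁, (dist_eq_norm (G y) (G y₀)).symm.trans_lt h₂, by rwa [← dist_eq_norm], h₄, h₅⟩
  obtain ⟨ρ, hρ, hball⟩ := Metric.eventually_nhds_iff_ball.1 hev
  -- With this `κ` the metric changes by at most m²δ between `y` and `y'`, and m²‖v‖² is controlled
  -- by the square of `h y₀ v`. Using `L + 1` avoids division by zero.
  refine ⟨ρ, hρ, m ^ 2 / (L + 1), by positivity, fun y hy y' hy' δ hδ hyy' v hv hv' => ?_⟩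
  obtain ⟨hy₁, hy₂, hy₃, -, -⟩ := hball y hy
  obtain ⟨hy'₁, hy'₂, hy'₃, hy'₄, hy'₅⟩ := hball y' hy'
  have hv0 : 0 < ‖v‖ := norm_pos_iff.2 (by rintro rfl; simp at hv)
  have h₁ : m * ‖v‖ ≤ |h y₀ v| := by
    refine hbound v ?_
    have := apply_apply_le_add' (G y₀) (G y) v v
    nlinarith [mul_pos hv0 hv0]
  have h₂ : m * ‖v‖ ≤ - h y₀ v := by
    rcases abs_cases (h y₀ v) with ⟨h₂, -⟩ | ⟨h₂, -⟩
    · have := apply_le_apply_add (h y₀) (h y) v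
      rw [norm_sub_rev] at this
      nlinarith
    · linarith
  set T := - h y₀ v with hT
  have hT0 : 0 < T := lt_of_lt_of_le (by positivity) h₂
  have hw : v - (δ * h y₀ v) • o = v + (δ * T) • o := by
    rw [hT, mul_neg, neg_smul, sub_eq_add_neg]
  rw [hw]
  -- Moving the base point costs less than δT². The cross term of the square gains at least δT², and
  -- the remaining term is nonpositive.
  have hvv : G y' v v < δ * T ^ 2 := by
    have h₃ := apply_apply_le_add (G y') (G y) v v
    have h₄ : ‖G y' - G y‖ ≤ m ^ 2 * δ := by
      have h₅ := hL.dist_le_mul y' hy'₁ y hy₁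
      rw [dist_eq_norm, dist_eq_norm] at h₅
      have hL0 : (0 : ℝ) ≤ L := L.2
      calc ‖G y' - G y‖ ≤ L * ‖y' - y‖ := h₅
        _ ≤ (L + 1) * (m ^ 2 / (L + 1) * δ) := by gcongr; linarith
        _ = m ^ 2 * δ := by field_simp
    have h₆ : ‖G y' - G y‖ * ‖v‖ * ‖v‖ ≤ δ * T ^ 2 :=
      calc ‖G y' - G y‖ * ‖v‖ * ‖v‖ ≤ m ^ 2 * δ * ‖v‖ * ‖v‖ := by gcongr
        _ = δ * (m * ‖v‖) ^ 2 := by ring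
        _ ≤ δ * T ^ 2 := by gcongr
    linarith
  have hov : G y' o v ≤ - T / 2 := by
    have h₃ := apply_apply_le_add (G y') (G y₀) o v
    have h₄ : ‖G y' - G y₀‖ * ‖o‖ * ‖v‖ ≤ m / 2 * ‖v‖ :=
      calc _ ≤ η * ‖o‖ * ‖v‖ := by gcongr
        _ ≤ _ := by gcongr
    have h₅ : G y₀ o v = - T := by rw [← hho, hT, neg_neg]
    linarith
  constructor
  · have hexp : G y' (v + (δ * T) • o) (v + (δ * T) • o) =
        G y' v v + 2 * (δ * T) * G y' o v + (δ * T) ^ 2 * G y' o o := by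
      have := hs y' v o
      simp [this]; ring
    rw [hexp]
    have h₃ : 2 * (δ * T) * G y' o v ≤ 2 * (δ * T) * (- T / 2) := by gcongr
    have h₄ : (δ * T) ^ 2 * G y' o o ≤ 0 := mul_nonpos_of_nonneg_of_nonpos (by positivity) hy'₄.le
    linarith [show 2 * (δ * T) * (- T / 2) = - (δ * T ^ 2) by ring]
  · have h₃ := apply_le_apply_add (h y') (h y₀) v
    have h₄ : ‖h y' - h y₀‖ * ‖v‖ ≤ m / 2 * ‖v‖ := by gcongr; linarith
    have h₅ : δ * T * h y' o ≤ 0 := mul_nonpos_of_nonneg_of_nonpos (by positivity) hy'₅.le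
    simp only [map_add, map_smul, smul_eq_mul]
    linarith

theorem norm_pushed_sub_le {τ : E →L[ℝ] ℝ} {o u x y c : E} {r κ δ ρ : ℝ} (hδ : 0 < δ)
    (hr : r ≤ ρ / 2) (hτ : ‖τ‖ * ‖o‖ * (2 * r) ≤ κ / 2) (hκδ : κ * δ < ρ / 2)
    (hx : x ∈ Metric.ball c r) (hy : y ∈ Metric.ball c r) (hu : ‖u‖ ≤ κ / 2 * δ) :
    x + u - (δ * τ (x - y)) • o ∈ Metric.ball c ρ ∧ ‖u - (δ * τ (x - y)) • o‖ ≤ κ * δ := by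
  have h₁ : ‖x - y‖ ≤ 2 * r := by
    have := dist_triangle_right x y c
    rw [← dist_eq_norm]
    linarith [Metric.mem_ball.1 hx, Metric.mem_ball.1 hy]
  have h₂ : ‖(δ * τ (x - y)) • o‖ ≤ δ * (κ / 2) := by
    rw [norm_smul, norm_mul, Real.norm_of_nonneg hδ.le]
    calc δ * ‖τ (x - y)‖ * ‖o‖ ≤ δ * (‖τ‖ * (2 * r)) * ‖o‖ := by
          gcongr
          exact τ.le_opNorm_of_le h₁
      _ = δ * (‖τ‖ * ‖o‖ * (2 * r)) := by ring
      _ ≤ δ * (κ / 2) := by gcongr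
  have h₃ : ‖u - (δ * τ (x - y)) • o‖ ≤ κ * δ := by
    linarith [norm_sub_le u ((δ * τ (x - y)) • o)]
  refine ⟨?_, h₃⟩
  have h₄ : x + u - (δ * τ (x - y)) • o - c = (x - c) + (u - (δ * τ (x - y)) • o) := by abel
  rw [mem_ball_iff_norm, h₄]
  linarith [norm_add_le (x - c) (u - (δ * τ (x - y)) • o), mem_ball_iff_norm.1 hx]

end Cones

end CBoundary

/-! ### Calculus of piecewise smooth curves, and time duality -/

namespace CBoundary

namespace Spacetime

/-! ## Piecewise smooth curves -/

section Curves

variable {n : ℕ} {M : Type*} [TopologicalSpace M] [ChartedSpace (EuclideanSpace ℝ (Fin n)) M]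
  {C C' : ∀ x : M, TangentSpace (𝓡 n) x → Prop} {γ γ' : ℝ → M} {a b c s t : ℝ}

theorem SmoothOnWith.congr (h : SmoothOnWith C γ a b) (heq : EqOn γ' γ (Icc a b)) :
    SmoothOnWith C γ' a b := by
  obtain ⟨hab, hsm, hC⟩ := h
  refine ⟨hab, hsm.congr heq, fun t ht => congr_cone (heq ht).symm ?_ (hC t ht)⟩
  exact congrArg (fun L : ℝ →L[ℝ] EuclideanSpace ℝ (Fin n) => L 1)
    (mfderivWithin_congr heq (heq ht)).symm

theorem SmoothOnWith.mono (h : SmoothOnWith C γ a b) (hC : ∀ x v, C x v → C' x v) :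
    SmoothOnWith C' γ a b :=
  ⟨h.1, h.2.1, fun t ht => hC _ _ (h.2.2 t ht)⟩

theorem SmoothOnWith.comp_affine {ε τ a' b' : ℝ} (h : SmoothOnWith C γ a b) (hab' : a' < b')
    (hmaps : MapsTo (fun t => ε * t + τ) (Icc a' b') (Icc a b))
    (hC : ∀ x (v : TangentSpace (𝓡 n) x), C x v → C' x (ε • v)) :
    SmoothOnWith C' (fun t => γ (ε * t + τ)) a' b' := by
  obtain ⟨hab, hsm, hCγ⟩ := h
  have hθ : ContDiff ℝ ∞ (fun t : ℝ => ε * t + τ) := by fun_prop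
  refine ⟨hab', hsm.comp hθ.contMDiff.contMDiffOn hmaps, fun t ht => ?_⟩
  have hd := mfderivWithin_comp (I := 𝓘(ℝ, ℝ)) (I' := 𝓘(ℝ, ℝ)) (I'' := 𝓡 n) t (g := γ)
    (f := fun t : ℝ => ε * t + τ) (s := Icc a' b') (u := Icc a b)
    ((hsm _ (hmaps ht)).mdifferentiableWithinAt (by norm_num))
    ((hθ.contMDiff.mdifferentiableAt (by norm_num)).mdifferentiableWithinAt) hmaps
    ((uniqueDiffOn_Icc hab' t ht).uniqueMDiffWithinAt)
  refine congr_cone rfl ?_ (hC _ _ (hCγ _ (hmaps ht)))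
  have hd' := congrArg (fun L : ℝ →L[ℝ] EuclideanSpace ℝ (Fin n) => L 1) hd
  refine Eq.trans ?_ hd'.symm
  have h₁ : (mfderivWithin 𝓘(ℝ, ℝ) 𝓘(ℝ, ℝ) (fun t : ℝ => ε * t + τ) (Icc a' b') t) (1 : ℝ) =
      ε • (1 : ℝ) := by
    rw [mfderivWithin_eq_fderivWithin]
    have : HasDerivWithinAt (fun t : ℝ => ε * t + τ) ε (Icc a' b') t := by
      simpa using (((hasDerivAt_id t).const_mul ε).add_const τ).hasDerivWithinAt
    have h₂ := this.derivWithin (uniqueDiffOn_Icc hab' t ht)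
    rw [derivWithin] at h₂
    exact h₂.trans (mul_one ε).symm
  have h₃ : ∀ (L : ℝ →L[ℝ] EuclideanSpace ℝ (Fin n)) (x : ℝ), x = ε • (1 : ℝ) →
      ε • L 1 = L x := fun L x hx => by rw [hx, map_smul]
  exact h₃ _ _ h₁

theorem SmoothOnWith.subinterval (h : SmoothOnWith C γ a b) (has : a ≤ s) (hst : s < t)
    (htb : t ≤ b) : SmoothOnWith C γ s t := by
  have := h.comp_affine (C' := C) (ε := 1) (τ := 0) hst
    (fun u hu => by simpa using ⟨has.trans hu.1, hu.2.trans htb⟩)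
    (fun x v hv => by simpa using hv)
  simpa using this

theorem SmoothOnWith.shift (h : SmoothOnWith C γ a b) (τ : ℝ) :
    SmoothOnWith C (fun u => γ (u - τ)) (a + τ) (b + τ) := by
  have := h.comp_affine (C' := C) (ε := 1) (τ := -τ) (a' := a + τ) (b' := b + τ)
    (by linarith [h.1])
    (fun u hu => ⟨by linarith [hu.1], by linarith [hu.2]⟩) (fun x v hv => by simpa using hv)
  simpa [sub_eq_add_neg] using this

theorem SmoothOnWith.reverse (h : SmoothOnWith C γ a b) (hC : ∀ x v, C x v → C' x (-v)) :
    SmoothOnWith C' (fun u => γ (-u)) (-b) (-a) := by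
  have := h.comp_affine (C' := C') (ε := -1) (τ := 0) (a' := -b) (b' := -a)
    (by linarith [h.1])
    (fun u hu => ⟨by linarith [hu.2], by linarith [hu.1]⟩)
    (fun x v hv => by simpa using hC x v hv)
  simpa using this

theorem PiecewiseSmoothOnWith.lt (h : PiecewiseSmoothOnWith C γ a b) : a < b := by
  induction h with
  | single h => exact h.1
  | tail _ h ih => exact ih.trans h.1

theorem PiecewiseSmoothOnWith.map (h : PiecewiseSmoothOnWith C γ a b)
    (hmap : ∀ s t, a ≤ s → t ≤ b → SmoothOnWith C γ s t → SmoothOnWith C' γ' s t) :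
    PiecewiseSmoothOnWith C' γ' a b := by
  induction h with
  | single h => exact .single (hmap _ _ le_rfl le_rfl h)
  | tail h h' ih =>
    exact (ih fun s t hs ht => hmap s t hs (ht.trans h'.1.le)).tail
      (hmap _ _ (PiecewiseSmoothOnWith.lt h).le le_rfl h')

theorem PiecewiseSmoothOnWith.congr (h : PiecewiseSmoothOnWith C γ a b)
    (heq : EqOn γ' γ (Icc a b)) : PiecewiseSmoothOnWith C γ' a b :=
  h.map fun _ _ hs ht h' => h'.congr (heq.mono (Icc_subset_Icc hs ht))

theorem PiecewiseSmoothOnWith.mono (h : PiecewiseSmoothOnWith C γ a b)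
    (hC : ∀ x v, C x v → C' x v) : PiecewiseSmoothOnWith C' γ a b :=
  h.map fun _ _ _ _ h' => h'.mono hC

theorem PiecewiseSmoothOnWith.shift (h : PiecewiseSmoothOnWith C γ a b) (τ : ℝ) :
    PiecewiseSmoothOnWith C (fun u => γ (u - τ)) (a + τ) (b + τ) := by
  induction h with
  | single h => exact .single (h.shift τ)
  | tail _ h ih => exact ih.tail (h.shift τ)

theorem PiecewiseSmoothOnWith.reverse (h : PiecewiseSmoothOnWith C γ a b)
    (hC : ∀ x v, C x v → C' x (-v)) :
    PiecewiseSmoothOnWith C' (fun u => γ (-u)) (-b) (-a) := by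
  induction h with
  | single h => exact .single (h.reverse hC)
  | tail _ h ih => exact .head (h.reverse hC) ih

theorem PiecewiseSmoothOnWith.restrict_left (h : PiecewiseSmoothOnWith C γ a b) (has : a ≤ s)
    (hsb : s < b) : PiecewiseSmoothOnWith C γ s b := by
  induction h with
  | single h => exact .single (h.subinterval has hsb le_rfl)
  | @tail c d _ h ih =>
    rcases lt_or_ge s c with hsc | hcs
    · exact (ih hsc).tail h
    · exact .single (h.subinterval hcs hsb le_rfl)

theorem PiecewiseSmoothOnWith.exists_last_piece (h : PiecewiseSmoothOnWith C γ a b) :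
    ∃ c, SmoothOnWith C γ c b ∧ ∀ t, c < t → t < b → PiecewiseSmoothOnWith C γ a t := by
  cases h with
  | single h => exact ⟨a, h, fun t h₁ h₂ => .single (h.subinterval le_rfl h₁ h₂.le)⟩
  | @tail c _ h h' => exact ⟨c, h', fun t h₁ h₂ => h.tail (h'.subinterval le_rfl h₁ h₂.le)⟩

theorem PiecewiseSmoothOnWith.exists_concat {d : ℝ} (h : PiecewiseSmoothOnWith C γ a b)
    (h' : PiecewiseSmoothOnWith C γ' c d) (heq : γ b = γ' c) :
    ∃ (α : ℝ → M) (e : ℝ), PiecewiseSmoothOnWith C α a b ∧ PiecewiseSmoothOnWith C α b e ∧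
      α a = γ a ∧ α b = γ b ∧ α e = γ' d := by
  have h₂ := h'.shift (b - c)
  rw [add_sub_cancel] at h₂
  refine ⟨fun u => if u ≤ b then γ u else γ' (u - (b - c)), d + (b - c),
    h.congr fun u hu => by simp [hu.2], h₂.congr fun u hu => ?_, by simp [h.lt.le], by simp, ?_⟩
  · rcases hu.1.eq_or_lt with rfl | hlt
    · simp [heq]
    · simp [hlt.not_ge]
  · simp [h₂.lt.not_ge]

end Curves

variable {n : ℕ} {M : Type*} [TopologicalSpace M]
  [ChartedSpace (EuclideanSpace ℝ (Fin n)) M] [IsManifold (𝓡 n) ∞ M] (S : Spacetime n M)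

theorem Chr.trans {S : Spacetime n M} {x y z : M} (h : S.Chr x y) (h' : S.Chr y z) :
    S.Chr x z := by
  obtain ⟨γ, a, b, hγ, rfl, rfl⟩ := h
  obtain ⟨γ', c, d, hγ', h₁, rfl⟩ := h'
  obtain ⟨α, e, hα, hα', h₂, -, h₃⟩ := hγ.exists_concat hγ' h₁.symm
  exact ⟨α, a, e, Relation.TransGen.trans hα hα', h₂, h₃⟩

/-! ## Time duality -/

/-- The spacetime with the opposite time orientation. -/
noncomputable def dual : Spacetime n M where
  g := S.g
  symm := S.symm
  lorentzian := S.lorentzian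
  contMDiff := S.contMDiff
  orient x := - S.orient x
  orient_timelike x := by simpa using S.orient_timelike x
  orient_continuous := by
    have h : ContMDiff (𝓡 n) (𝓡 n).tangent 0
      (fun x => (⟨x, S.orient x⟩ : TangentBundle (𝓡 n) M)) :=
        contMDiff_zero_iff.2 S.orient_continuous
    exact contMDiff_zero_iff.1 h.neg_section

theorem dual_dual : S.dual.dual = S := by
  simp [dual]

theorem futureTimelike_dual_iff {x : M} {v : TangentSpace (𝓡 n) x} :
    S.dual.FutureTimelike x v ↔ S.PastTimelike x v := by
  simp [FutureTimelike, PastTimelike, dual]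

theorem futureTimelike_dual_neg {x : M} {v : TangentSpace (𝓡 n) x}
    (h : S.FutureTimelike x v) : S.dual.FutureTimelike x (-v) := by
  simpa [FutureTimelike, dual] using h

theorem Chr.dual {S : Spacetime n M} {x y : M} (h : S.Chr x y) : S.dual.Chr y x := by
  obtain ⟨γ, a, b, hγ, rfl, rfl⟩ := h
  exact ⟨fun t => γ (-t), -b, -a, hγ.reverse fun _ _ => S.futureTimelike_dual_neg, by simp,
    by simp⟩

theorem chr_dual_iff {x y : M} : S.dual.Chr x y ↔ S.Chr y x :=
  ⟨fun h => S.dual_dual ▸ h.dual, Chr.dual⟩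

/-- Strong causality for timelike curves. -/
def TimelikeStronglyCausal : Prop :=
  ∀ p : M, ∀ U ∈ 𝓝 p, ∃ V ∈ 𝓝 p, ∀ (γ : ℝ → M) (a b : ℝ),
    PiecewiseSmoothOnWith S.FutureTimelike γ a b → γ a ∈ V → γ b ∈ V → ∀ t ∈ Icc a b, γ t ∈ U

theorem StronglyCausal.timelike {S : Spacetime n M} (h : S.StronglyCausal) :
    S.TimelikeStronglyCausal := fun p U hU => by
  obtain ⟨V, hV, -, hVU⟩ := h p U hU
  refine ⟨V, hV, fun γ a b hγ => hVU γ a b (hγ.mono fun x v hv => ⟨?_, hv.1.le, hv.2⟩)⟩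
  rintro rfl
  simpa using hv.1

theorem TimelikeStronglyCausal.dual {S : Spacetime n M} (h : S.TimelikeStronglyCausal) :
    S.dual.TimelikeStronglyCausal := fun p U hU => by
  obtain ⟨V, hV, hVU⟩ := h p U hU
  refine ⟨V, hV, fun γ a b hγ ha hb t ht => ?_⟩
  have := hVU _ _ _ (hγ.reverse (C' := S.FutureTimelike) fun x v hv => by
    simpa [S.dual_dual] using S.dual.futureTimelike_dual_neg hv) (by simpa) (by simpa) (-t)
    ⟨neg_le_neg ht.2, neg_le_neg ht.1⟩
  simpa using this

theorem TimelikeStronglyCausal.convex {S : Spacetime n M} (h : S.TimelikeStronglyCausal) (p : M)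
    (U : Set M) (hU : U ∈ 𝓝 p) :
    ∃ V ∈ 𝓝 p, ∀ x ∈ V, ∀ z ∈ V, ∀ y, S.Chr x y → S.Chr y z → y ∈ U := by
  obtain ⟨V, hV, hVU⟩ := h p U hU
  refine ⟨V, hV, fun x hx z hz y hxy hyz => ?_⟩
  obtain ⟨γ, a, b, hγ, rfl, rfl⟩ := hxy
  obtain ⟨γ', c, d, hγ', h₁, rfl⟩ := hyz
  obtain ⟨α, e, hα, hα', h₂, h₃, h₄⟩ := hγ.exists_concat hγ' h₁.symm
  rw [← h₃]
  exact hVU α a e (Relation.TransGen.trans hα hα') (h₂ ▸ hx) (h₄ ▸ hz) b ⟨hα.lt.le, hα'.lt.le⟩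

end Spacetime

end CBoundary

/-! ### The chronology of a strongly causal spacetime -/

namespace CBoundary

namespace Spacetime

variable {n : ℕ} {M : Type*} [TopologicalSpace M]
  [ChartedSpace (EuclideanSpace ℝ (Fin n)) M] [IsManifold (𝓡 n) ∞ M] (S : Spacetime n M)

/-! ## Local properties of the chronological relation -/

theorem exists_chartTimelike (p : M) : ∃ o, S.chartMetric p (extChartAt (𝓡 n) p p) o o < 0 ∧
    (∀ v, S.chartTime p (extChartAt (𝓡 n) p p) v =
      S.chartMetric p (extChartAt (𝓡 n) p p) o v) ∧
    ∀ v, v ≠ 0 → S.chartMetric p (extChartAt (𝓡 n) p p) o v = 0 →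
      0 < S.chartMetric p (extChartAt (𝓡 n) p p) v v := by
  set y₀ := extChartAt (𝓡 n) p p
  set x := (extChartAt (𝓡 n) p).symm y₀
  obtain ⟨D, hD⟩ := isInvertible_chartDeriv (n := n) (mem_extChartAt_target (I := 𝓡 n) p)
  have hD' : ∀ v, chartDeriv n p y₀ v = D v := fun v => by rw [← hD]; rfl
  have hDs : ∀ v, chartDeriv n p y₀ (D.symm v) = v := fun v => by rw [hD']; simp
  let g : EuclideanSpace ℝ (Fin n) →L[ℝ] EuclideanSpace ℝ (Fin n) →L[ℝ] ℝ := S.g x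
  let O : EuclideanSpace ℝ (Fin n) := S.orient x
  obtain ⟨e, hepos⟩ : ∃ e, ∀ w, g e w = 0 → w ≠ 0 → 0 < g w w :=
    (S.lorentzian x).imp fun _ h => h.2
  have hm : ∀ v w, S.chartMetric p y₀ v w = g (chartDeriv n p y₀ v) (chartDeriv n p y₀ w) :=
    fun _ _ => rfl
  have ho : ∀ v, S.chartMetric p y₀ (D.symm O) v = S.chartTime p y₀ v := fun v => by
    rw [hm, hDs]; rfl
  have hoo : S.chartMetric p y₀ (D.symm O) (D.symm O) < 0 := by
    rw [hm, hDs]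
    exact S.orient_timelike x
  -- The witness is the orienting vector read in the chart, so pairing with it is `chartTime`.
  refine ⟨D.symm O, hoo, fun v => (ho v).symm, fun v hv hov => ?_⟩
  refine pos_of_orthogonal_timelike (fun v w => S.symm _ _ _) (e := D.symm e) (fun w hw hw0 => ?_)
    hoo hov hv
  rw [hm, hDs] at hw
  rw [hm]
  refine hepos _ hw fun h => hw0 ?_
  exact D.injective (((hD' w).symm.trans h).trans (map_zero D).symm)

/-- Short segments in a chart, with directions close to a future timelike vector, are timelike. -/
theorem exists_segment_chr (p : M) {y₀ v₀ : EuclideanSpace ℝ (Fin n)}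
    (hy₀ : y₀ ∈ (extChartAt (𝓡 n) p).target)
    (hv₀ : S.FutureTimelike ((extChartAt (𝓡 n) p).symm y₀) (chartDeriv n p y₀ v₀)) :
    ∃ ρ > 0, ∀ y ∈ Metric.ball y₀ ρ, ∀ z ∈ Metric.ball y₀ ρ, ∀ s : ℝ, 0 < s →
      s⁻¹ • (z - y) ∈ Metric.ball v₀ ρ →
      S.Chr ((extChartAt (𝓡 n) p).symm y) ((extChartAt (𝓡 n) p).symm z) := by
  have hnhds := (isOpen_extChartAt_target (I := 𝓡 n) p).mem_nhds hy₀
  have hG := (S.contDiffOn_chartMetric p).continuousOn.continuousAt hnhds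
  have hh := (S.continuousOn_chartTime p).continuousAt hnhds
  rw [futureTimelike_chart_iff] at hv₀
  have hG' : ContinuousAt (fun a : EuclideanSpace ℝ (Fin n) × EuclideanSpace ℝ (Fin n) =>
      S.chartMetric p a.1 a.2 a.2) (y₀, v₀) :=
    ((hG.comp (x := (y₀, v₀)) continuousAt_fst).clm_apply continuousAt_snd).clm_apply
      continuousAt_snd
  have hh₁ : ContinuousAt (fun a : EuclideanSpace ℝ (Fin n) × EuclideanSpace ℝ (Fin n) =>
      S.chartTime p a.1) (y₀, v₀) := 
    ContinuousAt.comp (f := Prod.fst) (g := S.chartTime p) hh continuousAt_fst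
  have hh' : ContinuousAt (fun a : EuclideanSpace ℝ (Fin n) × EuclideanSpace ℝ (Fin n) =>
      S.chartTime p a.1 a.2) (y₀, v₀) := hh₁.clm_apply continuousAt_snd
  have hev : ∀ᶠ a in 𝓝 (y₀, v₀), a.1 ∈ (extChartAt (𝓡 n) p).target ∧
      S.chartMetric p a.1 a.2 a.2 < 0 ∧ S.chartTime p a.1 a.2 < 0 := by
    filter_upwards [continuousAt_fst.preimage_mem_nhds (x := (y₀, v₀)) hnhds,
      hG'.eventually_lt_const hv₀.1, hh'.eventually_lt_const hv₀.2] with a h₁ h₂ h₃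
      using ⟨h₁, h₂, h₃⟩
  obtain ⟨ρ, hρ, hball⟩ := Metric.eventually_nhds_iff_ball.1 hev
  refine ⟨ρ, hρ, fun y hy z hz s hs hw => ?_⟩
  set w := s⁻¹ • (z - y) with hwdef
  have hβ : ∀ t ∈ Icc 0 s, y + t • w ∈ Metric.ball y₀ ρ := fun t ht => by
    have h := (convex_ball y₀ ρ).add_smul_sub_mem hy hz (t := t / s)
      ⟨div_nonneg ht.1 hs.le, (div_le_one hs).2 ht.2⟩
    rwa [hwdef, smul_smul, ← div_eq_mul_inv]
  have hprod : ∀ t ∈ Icc 0 s, (y + t • w, w) ∈ Metric.ball (y₀, v₀) ρ := fun t ht => by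
    rw [← ball_prod_same]; exact ⟨hβ t ht, hw⟩
  refine ⟨fun t => (extChartAt (𝓡 n) p).symm (y + t • w), 0, s, .single
    (smoothOnWith_of_chart hs (by fun_prop) (fun t ht => (hball _ (hprod t ht)).1)
      fun t ht => ?_), by simp, ?_⟩
  · have hd : HasDerivWithinAt (fun t : ℝ => y + t • w) w (Icc 0 s) t := by
      simpa using (((hasDerivAt_id t).smul_const w).const_add y).hasDerivWithinAt
    rw [hd.derivWithin (uniqueDiffOn_Icc hs t ht), futureTimelike_chart_iff]
    exact (hball _ (hprod t ht)).2
  · simp [hwdef, smul_smul, hs.ne']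

/-- In a chart, chords from late points of the curve to its endpoint have slopes tending to the
final velocity. One such chord can be swung to any nearby endpoint and remains timelike. -/
theorem isOpen_chr_future (p : M) : IsOpen {q | S.Chr p q} := by
  rw [isOpen_iff_mem_nhds]
  rintro q ⟨γ, a, b, hγ, rfl, rfl⟩
  obtain ⟨c, hc, hpiece⟩ := hγ.exists_last_piece
  obtain ⟨c', hcc', hc'b, hsrc⟩ : ∃ c', c ≤ c' ∧ c' < b ∧
      ∀ t ∈ Icc c' b, γ t ∈ (extChartAt (𝓡 n) (γ b)).source := by
    have hcont : ContinuousWithinAt γ (Icc c b) b := hc.2.1.continuousOn b ⟨hc.1.le, le_rfl⟩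
    have hev := hcont (extChartAt_source_mem_nhds (I := 𝓡 n) (γ b))
    rw [mem_map, nhdsWithin_Icc_eq_nhdsLE hc.1, mem_nhdsLE_iff_exists_Icc_subset] at hev
    obtain ⟨u, hu, hsub⟩ := hev
    exact ⟨max c u, le_max_left _ _, max_lt hc.1 hu, fun t ht =>
      hsub ⟨(le_max_right _ _).trans ht.1, ht.2⟩⟩
  have hc' := hc.subinterval hcc' hc'b le_rfl
  obtain ⟨hβ, hC⟩ := hc'.chart hsrc
  set β := fun t => extChartAt (𝓡 n) (γ b) (γ t)
  have hb : b ∈ Icc c' b := ⟨hc'b.le, le_rfl⟩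
  obtain ⟨ρ, hρ, hseg⟩ := S.exists_segment_chr (γ b)
    ((extChartAt (𝓡 n) (γ b)).map_source (hsrc b hb)) (hC b hb)
  have hder := (hβ.differentiableOn (by norm_num) b hb).hasDerivWithinAt
  have hslope := hasDerivWithinAt_iff_tendsto_slope.1 hder
  have hIcc : Icc c' b \ {b} = Ico c' b := Icc_sdiff_right
  rw [hIcc, nhdsWithin_Ico_eq_nhdsLT hc'b] at hslope
  have hcont : Tendsto β (𝓝[<] b) (𝓝 (β b)) := by
    have := hβ.continuousOn b hb
    rw [ContinuousWithinAt, nhdsWithin_Icc_eq_nhdsLE hc'b] at this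
    exact this.mono_left (nhdsWithin_mono _ Iio_subset_Iic_self)
  obtain ⟨t, hts, htβ, htc', htb⟩ := Filter.nonempty_of_mem (inter_mem
    (mem_map.1 (hslope (Metric.ball_mem_nhds _ hρ)))
    (inter_mem (hcont (Metric.ball_mem_nhds _ hρ)) (Ioo_mem_nhdsLT hc'b)))
  have hchr : S.Chr (γ a) (γ t) := ⟨γ, a, t, hpiece t (hcc'.trans_lt htc') htb, rfl, rfl⟩
  have htsrc := hsrc t ⟨htc'.le, htb.le⟩
  have hφ : ContinuousAt (extChartAt (𝓡 n) (γ b)) (γ b) := continuousAt_extChartAt _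
  have hsl : Tendsto (fun q => (b - t)⁻¹ • (extChartAt (𝓡 n) (γ b) q - β t)) (𝓝 (γ b))
      (𝓝 ((b - t)⁻¹ • (β b - β t))) := (hφ.tendsto.sub_const _).const_smul _
  have hmem : (b - t)⁻¹ • (β b - β t) ∈ Metric.ball (derivWithin β (Icc c' b) b) ρ := by
    have h : slope β b t ∈ Metric.ball (derivWithin β (Icc c' b) b) ρ := hts
    rwa [slope_comm, slope_def_module] at h
  filter_upwards [hsl (Metric.isOpen_ball.mem_nhds hmem), hφ (Metric.ball_mem_nhds _ hρ),
    extChartAt_source_mem_nhds (I := 𝓡 n) (γ b)] with q h₁ h₂ h₃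
  have := hseg (β t) htβ _ h₂ (b - t) (sub_pos.2 htb) h₁
  rw [(extChartAt (𝓡 n) (γ b)).left_inv htsrc, (extChartAt (𝓡 n) (γ b)).left_inv h₃] at this
  exact hchr.trans this

theorem isOpen_chr_past (p : M) : IsOpen {q | S.Chr q p} := by
  simpa only [chr_dual_iff] using S.dual.isOpen_chr_future p

theorem exists_chr_past (p : M) (U : Set M) (hU : U ∈ 𝓝 p) : ∃ q ∈ U, S.Chr q p := by
  obtain ⟨o, ho, hoh, -⟩ := S.exists_chartTimelike p
  set y₀ := extChartAt (𝓡 n) p p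
  have hp : (extChartAt (𝓡 n) p).symm y₀ = p := extChartAt_to_inv p
  obtain ⟨ρ, hρ, hseg⟩ := S.exists_segment_chr p (mem_extChartAt_target (I := 𝓡 n) p)
    ((S.futureTimelike_chart_iff p y₀ o).2 ⟨ho, hoh o ▸ ho⟩)
  have hcont : Tendsto (fun s : ℝ => y₀ - s • o) (𝓝[>] 0) (𝓝 y₀) := by
    have : Continuous fun s : ℝ => y₀ - s • o := by fun_prop
    simpa using (this.tendsto 0).mono_left nhdsWithin_le_nhds
  have hU' : (extChartAt (𝓡 n) p).symm ⁻¹' U ∈ 𝓝 y₀ :=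
    (continuousAt_extChartAt_symm p).preimage_mem_nhds (by rwa [hp])
  obtain ⟨s, hs, hsb, hsU⟩ := Filter.nonempty_of_mem (inter_mem
    (self_mem_nhdsWithin (a := (0 : ℝ)) (s := Ioi 0))
    (inter_mem (hcont (Metric.ball_mem_nhds _ hρ)) (hcont hU')))
  have hs' : (0 : ℝ) < s := hs
  refine ⟨_, hsU, ?_⟩
  have := hseg _ hsb y₀ (Metric.mem_ball_self hρ) s hs'
    (by simpa [smul_smul, hs'.ne'] using hρ)
  rwa [hp] at this

theorem exists_chr_future (p : M) (U : Set M) (hU : U ∈ 𝓝 p) : ∃ q ∈ U, S.Chr p q := by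
  simpa only [chr_dual_iff] using S.dual.exists_chr_past p U hU

/-- Timelike curves near `p` are mapped to timelike curves by suitable affine maps of the chart
close to the identity. -/
theorem exists_pushed_curve (p : M) : ∃ ρ > 0, ∃ κ > 0, ∃ (τ : EuclideanSpace ℝ (Fin n) →L[ℝ] ℝ)
    (o : EuclideanSpace ℝ (Fin n)), ∀ (γ : ℝ → M) (a b : ℝ), ∀ δ > 0, ∀ u y,
      PiecewiseSmoothOnWith S.FutureTimelike γ a b →
      (∀ t ∈ Icc a b, γ t ∈ (extChartAt (𝓡 n) p).source ∧
        extChartAt (𝓡 n) p (γ t) ∈ Metric.ball (extChartAt (𝓡 n) p p) ρ ∧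
        extChartAt (𝓡 n) p (γ t) + u - (δ * τ (extChartAt (𝓡 n) p (γ t) - y)) • o ∈
          Metric.ball (extChartAt (𝓡 n) p p) ρ ∧
        ‖u - (δ * τ (extChartAt (𝓡 n) p (γ t) - y)) • o‖ ≤ κ * δ) →
      PiecewiseSmoothOnWith S.FutureTimelike (fun t => (extChartAt (𝓡 n) p).symm
        (extChartAt (𝓡 n) p (γ t) + u - (δ * τ (extChartAt (𝓡 n) p (γ t) - y)) • o)) a b := by
  obtain ⟨o, ho, hoh, hpos⟩ := S.exists_chartTimelike p
  set y₀ := extChartAt (𝓡 n) p p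
  have hnhds := (isOpen_extChartAt_target (I := 𝓡 n) p).mem_nhds
    (mem_extChartAt_target (I := 𝓡 n) p)
  obtain ⟨ρ₁, hρ₁, κ, hκ, hpush⟩ := exists_pushed_timelike (y₀ := y₀)
    ((S.contDiffOn_chartMetric p).contDiffAt hnhds)
    ((S.continuousOn_chartTime p).continuousAt hnhds) (fun y v w => S.symm _ _ _) ho hoh hpos
  obtain ⟨ρ₂, hρ₂, hball⟩ := Metric.mem_nhds_iff.1 hnhds
  refine ⟨min ρ₁ ρ₂, lt_min hρ₁ hρ₂, κ, hκ, S.chartTime p y₀, o,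
    fun γ a b δ hδ u y hγ hmem => hγ.map fun s t hs ht h => ?_⟩
  have hsub : Icc s t ⊆ Icc a b := Icc_subset_Icc hs ht
  obtain ⟨hβ, hC⟩ := h.chart (p := p) fun t ht => (hmem t (hsub ht)).1
  set β := fun t => extChartAt (𝓡 n) p (γ t)
  have hsm : ContDiffOn ℝ ∞ (fun t => β t + u - (δ * S.chartTime p y₀ (β t - y)) • o)
      (Icc s t) :=
    (hβ.add contDiffOn_const).sub ((contDiffOn_const.mul
      ((S.chartTime p y₀).contDiff.comp_contDiffOn (hβ.sub contDiffOn_const))).smul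
        contDiffOn_const)
  refine smoothOnWith_of_chart h.1 hsm (fun r hr => hball (Metric.ball_subset_ball
    (min_le_right _ _) (hmem r (hsub hr)).2.2.1)) fun r hr => ?_
  have hd := (hβ.differentiableOn (by norm_num) r hr).hasDerivWithinAt
  have hd' : HasDerivWithinAt (fun t => β t + u - (δ * S.chartTime p y₀ (β t - y)) • o)
      (derivWithin β (Icc s t) r - (δ * S.chartTime p y₀ (derivWithin β (Icc s t) r)) • o)
      (Icc s t) r :=
    (hd.add_const u).sub ((((S.chartTime p y₀).hasFDerivAt.comp_hasDerivWithinAt r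
      (hd.sub_const y)).const_mul δ).smul_const o)
  rw [hd'.derivWithin (uniqueDiffOn_Icc h.1 r hr), futureTimelike_chart_iff]
  have hCr := (S.futureTimelike_chart_iff p _ _).1 (hC r hr)
  obtain ⟨-, h₁, h₂, h₃⟩ := hmem r (hsub hr)
  refine hpush (β r) (Metric.ball_subset_ball (min_le_left _ _) h₁) _
    (Metric.ball_subset_ball (min_le_left _ _) h₂) δ hδ ?_ _ hCr.1 hCr.2
  refine le_of_eq_of_le (congrArg norm ?_) h₃
  abel

/-- The affine map is normalised to send γ(a) to `q`. The translation brings the start to `q`, and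
the tilt vanishes there. -/
theorem exists_pushed_chr (p : M) : ∃ U ∈ 𝓝 p, U ⊆ (extChartAt (𝓡 n) p).source ∧
    ∃ κ > 0, ∃ δ₀ > 0, ∃ (τ : EuclideanSpace ℝ (Fin n) →L[ℝ] ℝ) (o : EuclideanSpace ℝ (Fin n)),
    ∀ (γ : ℝ → M) (a b : ℝ), PiecewiseSmoothOnWith S.FutureTimelike γ a b →
      (∀ t ∈ Icc a b, γ t ∈ U) → ∀ δ, 0 < δ → δ < δ₀ → ∀ q ∈ U,
      ‖extChartAt (𝓡 n) p q - extChartAt (𝓡 n) p (γ a)‖ ≤ κ * δ →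
      S.Chr q ((extChartAt (𝓡 n) p).symm (extChartAt (𝓡 n) p (γ b) +
        (extChartAt (𝓡 n) p q - extChartAt (𝓡 n) p (γ a)) -
        (δ * τ (extChartAt (𝓡 n) p (γ b) - extChartAt (𝓡 n) p (γ a))) • o)) := by
  obtain ⟨ρ, hρ, κ, hκ, τ, o, hpush⟩ := S.exists_pushed_curve p
  obtain ⟨r, hr0, hrρ, hrA⟩ : ∃ r > 0, r ≤ ρ / 2 ∧ ‖τ‖ * ‖o‖ * (2 * r) ≤ κ / 2 := by
    have hA0 : 0 ≤ ‖τ‖ * ‖o‖ := by positivity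
    refine ⟨min (ρ / 2) (κ / (4 * (‖τ‖ * ‖o‖ + 1))), by positivity, min_le_left _ _, ?_⟩
    have h₁ := min_le_right (ρ / 2) (κ / (4 * (‖τ‖ * ‖o‖ + 1)))
    rw [le_div_iff₀ (by positivity)] at h₁
    have h₂ : 0 < min (ρ / 2) (κ / (4 * (‖τ‖ * ‖o‖ + 1))) := by positivity
    linarith
  refine ⟨(extChartAt (𝓡 n) p).source ∩
    extChartAt (𝓡 n) p ⁻¹' Metric.ball (extChartAt (𝓡 n) p p) r,
    inter_mem (extChartAt_source_mem_nhds p)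
    ((continuousAt_extChartAt p).preimage_mem_nhds (Metric.ball_mem_nhds _ hr0)),
    inter_subset_left, κ / 2, by positivity, ρ / (2 * κ), by positivity, τ, o,
    fun γ a b hγ hγU δ hδ hδρ q hq hqa => ?_⟩
  have hκδ : κ * δ < ρ / 2 := by
    rw [lt_div_iff₀ (by positivity)] at hδρ
    linarith
  have haU := hγU a ⟨le_rfl, hγ.lt.le⟩
  refine ⟨_, a, b, hpush γ a b δ hδ (extChartAt (𝓡 n) p q - extChartAt (𝓡 n) p (γ a))
    (extChartAt (𝓡 n) p (γ a)) hγ fun t ht => ?_, ?_, rfl⟩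
  · have htU := hγU t ht
    exact ⟨htU.1, Metric.ball_subset_ball (by linarith) htU.2,
      norm_pushed_sub_le hδ hrρ hrA hκδ htU.2 haU.2 hqa⟩
  · rw [sub_self, map_zero, mul_zero, zero_smul, sub_zero, add_sub_cancel,
      (extChartAt (𝓡 n) p).left_inv hq.1]

/-- Take timelike curves from `w` near `q` to `w'` near `q'`, kept in the chart by strong causality,
and move them to start exactly at `q`. Their new endpoints are so close to `q'` that they still lie
in the open set I⁻(z). -/
theorem TimelikeStronglyCausal.push_future {S : Spacetime n M} (hS : S.TimelikeStronglyCausal)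
    (p : M) : ∃ V ∈ 𝓝 p, ∀ q ∈ V, ∀ q' ∈ V, ClosureRel S.Chr q q' →
      ∀ z, S.Chr q' z → S.Chr q z := by
  obtain ⟨U, hUp, hUsrc, κ, hκ, δ₀, hδ₀, τ, o, hpush⟩ := S.exists_pushed_chr p
  obtain ⟨V, hV, hVU⟩ := hS p U hUp
  refine ⟨interior V ∩ interior U, inter_mem (interior_mem_nhds.2 hV) (interior_mem_nhds.2 hUp),
    fun q hq q' hq' hcl z hz => ?_⟩
  have hqU := interior_subset hq.2
  have hqs := hUsrc hqU
  have hqs' := hUsrc (interior_subset hq'.2)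
  generalize hφ : extChartAt (𝓡 n) p = φ at *
  have hcq : ContinuousAt φ q := hφ ▸ continuousAt_extChartAt' (hφ ▸ hqs)
  have hcq' : ContinuousAt φ q' := hφ ▸ continuousAt_extChartAt' (hφ ▸ hqs')
  let f : ℝ × M × M → EuclideanSpace ℝ (Fin n) := fun a =>
    φ a.2.2 + (φ q - φ a.2.1) - (a.1 * τ (φ a.2.2 - φ a.2.1)) • o
  have hf0 : f (0, q, q') = φ q' := by simp [f]
  have hfc : ContinuousAt f (0, q, q') := by
    have h₁ : ContinuousAt (fun a : ℝ × M × M => φ a.2.1) (0, q, q') :=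
      ContinuousAt.comp (f := fun a : ℝ × M × M => a.2.1) (g := φ) hcq (by fun_prop)
    have h₂ : ContinuousAt (fun a : ℝ × M × M => φ a.2.2) (0, q, q') :=
      ContinuousAt.comp (f := fun a : ℝ × M × M => a.2.2) (g := φ) hcq' (by fun_prop)
    have h₃ : ContinuousAt (fun a : ℝ × M × M => τ (φ a.2.2 - φ a.2.1)) (0, q, q') :=
      τ.continuous.continuousAt.comp (h₂.sub h₁)
    exact (h₂.add (continuousAt_const.sub h₁)).sub ((continuousAt_fst.mul h₃).smul
      continuousAt_const)
  have hfψ : ContinuousAt (fun a => φ.symm (f a)) (0, q, q') := by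
    refine ContinuousAt.comp (g := φ.symm) ?_ hfc
    rw [hf0]
    exact hφ ▸ continuousAt_extChartAt_symm' (hφ ▸ hqs')
  have hev : ∀ᶠ a in 𝓝 ((0 : ℝ), q, q'), S.Chr (φ.symm (f a)) z :=
    hfψ.eventually ((S.isOpen_chr_past z).mem_nhds (by
      change S.Chr (φ.symm (f (0, q, q'))) z
      rw [hf0, φ.left_inv hqs']; exact hz))
  rw [nhds_prod_eq] at hev
  -- The tilt `δ` is fixed before `w` and `w'`, because `w` must be within `κ * δ` of `q` in the
  -- chart.
  obtain ⟨δ, hδev, hδ, hδδ₀⟩ := ((hev.curry.filter_mono nhdsWithin_le_nhds).and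
    (Ioo_mem_nhdsGT hδ₀)).exists
  rw [nhds_prod_eq] at hδev
  obtain ⟨W, hW, W', hW', hWW'⟩ := mem_prod_iff.1 hδev
  have hnear : ∀ᶠ w in 𝓝 q, ‖φ q - φ w‖ ≤ κ * δ := by
    filter_upwards [Metric.tendsto_nhds.1 hcq (κ * δ) (by positivity)] with w hw
    rw [← dist_eq_norm, dist_comm]
    exact hw.le
  obtain ⟨w, ⟨⟨hwW, hwV⟩, hwq⟩, w', ⟨hwW', hwV'⟩, γ, a, b, hγ, rfl, rfl⟩ := hcl _
    (inter_mem (inter_mem hW (isOpen_interior.mem_nhds hq.1)) hnear) _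
    (inter_mem hW' (isOpen_interior.mem_nhds hq'.1))
  exact (hpush γ a b hγ (hVU γ a b hγ (interior_subset hwV) (interior_subset hwV')) δ hδ hδδ₀ q
    hqU hwq).trans (hWW' (mk_mem_prod hwW hwW'))

theorem StronglyCausal.chronology {S : Spacetime n M} (hS : S.StronglyCausal) :
    Chronology S.Chr where
  trans := Chr.trans
  isOpen_past := S.isOpen_chr_past
  isOpen_future := S.isOpen_chr_future
  exists_past := S.exists_chr_past
  exists_future := S.exists_chr_future
  convex := hS.timelike.convex
  push_future := hS.timelike.push_future
  push_past p := by
    obtain ⟨V, hV, h⟩ := hS.timelike.dual.push_future p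
    refine ⟨V, hV, fun q hq q' hq' hc z hz => chr_dual_iff S |>.1
      (h q' hq' q hq (fun W hW W' hW' => ?_) z hz.dual)⟩
    obtain ⟨w, hw, w', hw', hr⟩ := hc W' hW' W hW
    exact ⟨w', hw', w, hw, hr.dual⟩

/-! ## Curves without endpoint -/

theorem eventually_endFilter {b : EReal} {a t : ℝ} (hat : a ≤ t) (htb : (t : EReal) < b) :
    ∀ᶠ s in endFilter b, s ∈ {s : ℝ | a ≤ s ∧ (s : EReal) < b} ∧ t < s := by
  refine mem_comap.2 ⟨Ioo (t : EReal) b, Ioo_mem_nhdsLT htb, fun s hs => ?_⟩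
  have hts : t < s := EReal.coe_lt_coe_iff.1 hs.1
  exact ⟨⟨hat.trans hts.le, hs.2⟩, hts⟩

instance (b : EReal) : (endFilter b).IsCountablyGenerated := by
  unfold endFilter; infer_instance

theorem IsCurveWith.chr {S : Spacetime n M} {γ : ℝ → M} {a : ℝ} {b : EReal}
    (h : IsCurveWith S.FutureTimelike γ a b) :
    ∀ s ∈ {s : ℝ | a ≤ s ∧ (s : EReal) < b}, ∀ t ∈ {s : ℝ | a ≤ s ∧ (s : EReal) < b}, s < t →
      S.Chr (γ s) (γ t) := fun s hs t ht hst =>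
  ⟨γ, s, t, (h.2 t (hs.1.trans_lt hst) ht.2).restrict_left hs.1 hst, rfl, rfl⟩

end Spacetime

end CBoundary

/-! ### The theorem -/

theorem theorem3p22 {n : ℕ} (hn : 2 ≤ n) {M : Type*} [TopologicalSpace M]
    [ChartedSpace (EuclideanSpace ℝ (Fin n)) M] [IsManifold (𝓡 n) ∞ M]
    [T2Space M] [SecondCountableTopology M] [ConnectedSpace M]
    (S : CBoundary.Spacetime n M) (hS : S.StronglyCausal)
    (Mbar : CBoundary.AdmissibleCompletion S.Chr) :
    -- (i) future and past chains in the completion have a limit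
    ((∀ σ : ℕ → Mbar.Point, (∀ k, (σ k).Chr (σ (k + 1))) →
        ∃ x : Mbar.Point, Tendsto σ atTop (𝓝 x)) ∧
     (∀ σ : ℕ → Mbar.Point, (∀ k, (σ (k + 1)).Chr (σ k)) →
        ∃ x : Mbar.Point, Tendsto σ atTop (𝓝 x)) ∧
    -- and so do inextensible future- or past-directed timelike curves, in the boundary
     (∀ (γ : ℝ → M) (a : ℝ) (b : EReal),
        CBoundary.Spacetime.IsCurveWith S.FutureTimelike γ a b ∨
          CBoundary.Spacetime.IsCurveWith S.PastTimelike γ a b →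
        CBoundary.Spacetime.Inextensible γ b →
        ∃ x ∈ Mbar.boundary,
          Tendsto (fun t => Mbar.incl (γ t)) (CBoundary.Spacetime.endFilter b) (𝓝 x))) ∧
    -- (ii) the inclusion is an embedding with dense image
    (IsEmbedding Mbar.incl ∧ DenseRange Mbar.incl) ∧
    -- (iii) the boundary is closed
    IsClosed Mbar.boundary ∧
    -- (iv) chronological futures and pasts are open
    (∀ x : Mbar.Point, IsOpen {y : Mbar.Point | x.Chr y} ∧ IsOpen {y : Mbar.Point | y.Chr x}) ∧
    -- (v) points are closed
    T1Space Mbar.Point := by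
  have C := hS.chronology
  have hlc : LocallyCompactSpace M :=
    ChartedSpace.locallyCompactSpace (EuclideanSpace ℝ (Fin n)) M
  refine ⟨⟨fun _ => CBoundary.AdmissibleCompletion.exists_tendsto_of_futureChain C,
    fun _ => CBoundary.AdmissibleCompletion.exists_tendsto_of_pastChain C, ?_⟩,
    ⟨CBoundary.AdmissibleCompletion.isEmbedding_incl C,
      CBoundary.AdmissibleCompletion.denseRange_incl C⟩,
    CBoundary.AdmissibleCompletion.isClosed_boundary C,
    fun x => ⟨CBoundary.AdmissibleCompletion.isOpen_future x,
      CBoundary.AdmissibleCompletion.isOpen_past x⟩,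
    CBoundary.AdmissibleCompletion.t1Space⟩
  rintro γ a b (hγ | hγ) hext
  · exact CBoundary.AdmissibleCompletion.exists_mem_boundary_tendsto_of_futureCurve Mbar C
      (I := {t : ℝ | a ≤ t ∧ (t : EReal) < b})
      ⟨a, le_rfl, hγ.1⟩ (fun t ht => CBoundary.Spacetime.eventually_endFilter ht.1 ht.2)
      hγ.chr hext
  · have hγ' : CBoundary.Spacetime.IsCurveWith S.dual.FutureTimelike γ a b :=
      ⟨hγ.1, fun c hac hcb => (hγ.2 c hac hcb).mono
        fun x v hv => S.futureTimelike_dual_iff.2 hv⟩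
    exact CBoundary.AdmissibleCompletion.exists_mem_boundary_tendsto_of_pastCurve Mbar C
      (I := {t : ℝ | a ≤ t ∧ (t : EReal) < b})
      ⟨a, le_rfl, hγ.1⟩ (fun t ht => CBoundary.Spacetime.eventually_endFilter ht.1 ht.2)
      (fun s hs t ht hst => S.chr_dual_iff.1 (hγ'.chr s hs t ht hst)) hext
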